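/- A \emph{dimer} is a finite bipartite graph (nodes colored white and black, multiple edges allowed) embedded in the oriented torus $T^2=\mathbb{R}^2/\mathbb{Z}^2$. Its \emph{zigzag paths} are the closed oriented paths that go alternately from an edge to the counterclockwise next edge around its white endpoint, and from an edge to the clockwise next edge around its black endpoint; each zigzag path has a winding number in $H_1(T^2)=\mathbb{Z}^2$. The zigzag paths passing through a node $v$ are the ones that turn at $v$ from an edge to a consecutive edge around $v$; they are ordered cyclically around $v$. The dimer is \emph{properly ordered} if no zigzag path through a node has winding zero, zigzag paths that intersect in an edge have different winding directions and, for each node, the zigzag paths passing through it have pairwise different winding directions and their counterclockwise order around the node is the counterclockwise circular order of these directions. Choose closed curves $\gamma_w,\gamma_z$ on $T^2$ whose winding numbers generate $\mathbb{Z}^2$, and a nonzero complex number $c_e$ for every edge $e$. Let $a_e$ be the number of times that $\gamma_w$ crosses $e$ with the white endpoint on its left minus the number of times that it does so with the white endpoint on its right; define $b_e$ likewise with $\gamma_z$. The Kasteleyn matrix has one row for each white node, one column for each black node, and entries $K_{v,v'}=\sum_{e} c_e\,w^{a_e}z^{b_e}$, the sum being over the edges $e$ joining $v$ and $v'$. The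 \emph{toric diagram} is the Newton polygon (the convex hull of the exponents of the monomials that occur) of $\det K$; it is empty if there are not as many white nodes as black ones. A \emph{perfect matching} $M$ is a set of edges such that each node is an endpoint of exactly one edge of $M$; it corresponds to the point $\big(\sum_{e\in M}a_e,\sum_{e\in M}b_e\big)$. For a ray $\mathcal{R}$ from the origin that does not point in the direction of the winding number of any zigzag path, let $M(\mathcal{R})$ be the set of the edges $e(v)$, $v$ a node, where $e(v)$ is the edge at $v$ such that, of all zigzag paths through $v$, the one passing just before $e(v)$ (in counterclockwise order around $v$) makes the smallest clockwise angle with $\mathcal{R}$, and the one passing just after $e(v)$ makes the smallest counterclockwise angle with $\mathcal{R}$. \textbf{Theorem.} If a dimer is properly ordered, then for every corner (extreme point) $p$ of its toric diagram there is exactly one perfect matching that corresponds to $p$. Moreover, this perfect matching is $M(\mathcal{R})$ for some such ray $\mathcal{R}$. -/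

import Mathlib

/-- The exterior product `(a, b) ∧ (c, d) = a d - b c`. -/
def wedge (u v : ℤ × ℤ) : ℤ := u.1 * v.2 - u.2 * v.1

/-- The number of cycles of a permutation, fixed points included. -/
noncomputable def numCycles {E : Type*} (σ : Equiv.Perm E) : ℕ :=
  Nat.card (Quotient (Equiv.Perm.SameCycle.setoid σ))

/-- A connected bipartite graph with edge set `E`, drawn on the oriented torus `ℝ² / ℤ²` so that
every face is a disk, as a combinatorial map.

* `rotW e` (`rotB e`) is the next edge after `e`, counterclockwise around the white (black)
  endpoint of `e`; the white (black) vertices are the cycles of `rotW` (`rotB`).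
* Walking along `e` from white to black with a face on the left, the next sides of that face are
  `rotB⁻¹ e` (from black to white) and `rotW⁻¹ (rotB⁻¹ e)` (from white to black).  So the faces are
  the cycles of `rotW⁻¹ * rotB⁻¹`.
* `disp e` is the lattice displacement along `e` from white to black: a lift of every vertex to the
  plane is fixed, and the lift of `e` that starts at the chosen lift of its white endpoint
  ends at the chosen lift of its black endpoint translated by `disp e`.
* `corner`, `corner_next` develop each face, as a closed polygon in the plane, with all
  the chosen lifts moved to the origin: `corner e` is the position of the white corner of the face
  on the left of `e` at which the side `e` of this face starts.
* `euler` says that the surface obtained by gluing in a disk for each face is a torus.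
* `area` says that the signed areas of the developed faces add up to `1`, the area of `ℝ² / ℤ²`
  (the sum is twice the signed area, by the shoelace formula).  That is, the map to `ℝ² / ℤ²`
  given by `disp` has degree one, and so it is homotopic to an orientation preserving
  homeomorphism. -/
structure TorusMap (E : Type*) [Fintype E] where
  rotW : Equiv.Perm E
  rotB : Equiv.Perm E
  disp : E → ℤ × ℤ
  corner : E → ℤ × ℤ
  connected : ∀ e e' : E, ∃ g ∈ Subgroup.closure {rotW, rotB}, g e = e'
  euler : (numCycles rotW : ℤ) + (numCycles rotB : ℤ) - (Fintype.card E : ℤ)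
    + (numCycles (rotW⁻¹ * rotB⁻¹) : ℤ) = 0
  corner_next : ∀ e, corner (rotW⁻¹ (rotB⁻¹ e)) = corner e + disp e - disp (rotB⁻¹ e)
  area : ∑ e, (wedge (corner e) (disp e) - wedge (corner e + disp e) (disp (rotB⁻¹ e))) = 2

/-- `e'` is the first element of `S` that is met after `e` by iterating `σ`. -/
def IsNextIn {E : Type*} (σ : Equiv.Perm E) (S : Set E) (e e' : E) : Prop :=
  e' ∈ S ∧ ∃ k : ℕ, 0 < k ∧ (σ ^ k) e = e' ∧ ∀ j : ℕ, 0 < j → j < k → (σ ^ j) e ∉ S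

/-- A dimer model on the torus: a finite bipartite graph with white nodes `W`, black nodes `B` and
edges `E` (multiple edges allowed), embedded in the oriented torus `ℝ² / ℤ²`.

`rotW e` (`rotB e`) is the next edge counterclockwise around the white (black) endpoint of `e`, and
`disp e` is the lattice displacement along `e` from white to black, as in `TorusMap`.  Neither
connectedness nor that the faces are disks is assumed: a finite graph is embedded in the torus
exactly if it is, with the induced cyclic orders, a subgraph of a connected one whose faces
are disks (add nodes and edges inside the faces). -/
structure TorusDimer (W B E : Type*) where
  white : E → W
  black : E → B
  rotW : Equiv.Perm E
  rotB : Equiv.Perm E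
  sameCycle_rotW : ∀ e e', rotW.SameCycle e e' ↔ white e = white e'
  sameCycle_rotB : ∀ e e', rotB.SameCycle e e' ↔ black e = black e'
  disp : E → ℤ × ℤ
  embedded : ∃ (n : ℕ) (T : TorusMap (Fin n)) (ι : E ↪ Fin n),
    (∀ e, T.disp (ι e) = disp e) ∧
    (∀ e, IsNextIn T.rotW (Set.range ι) (ι e) (ι (rotW e))) ∧
    (∀ e, IsNextIn T.rotB (Set.range ι) (ι e) (ι (rotB e)))

/-- The direction (polar angle) of a nonzero integer vector. -/
noncomputable def direction (w : ℤ × ℤ) : Real.Angle :=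
  (Complex.arg ⟨(w.1 : ℝ), (w.2 : ℝ)⟩ : Real.Angle)

/-- The counterclockwise angle in `[0, 2π)` from the direction `θ₁` to the direction `θ₂`. It is
also the clockwise angle from `θ₂` to `θ₁`. -/
noncomputable def ccwAngle (θ₁ θ₂ : Real.Angle) : ℝ :=
  toIcoMod Real.two_pi_pos 0 (θ₂ - θ₁).toReal

namespace TorusDimer

variable {W B E : Type*} (D : TorusDimer W B E)

/-- Zigzag paths are oriented so as to go counterclockwise around white nodes and clockwise around
black nodes: from `e` to `rotW e` at the white endpoint of `e`, and then from `rotW e` to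
`rotB⁻¹ (rotW e)` at the black endpoint of `rotW e`.  The zigzag paths are the cycles
of this permutation; "the zigzag path of `e`" is the one that goes from `e` to `rotW e`.

Each edge `e` lies on its own zigzag path and on the zigzag path of `rotW⁻¹ e`, which is also
the zigzag path of `rotB⁻¹ e`; at `e` the latter crosses the former, and the direction of
the zigzag path of `e` is counterclockwise from that of the other one.
The zigzag paths passing through a node, in counterclockwise order around the node, are the zigzag
paths of the edges at that node, the zigzag path of `e` passing just after `e`. -/
def zigzag : Equiv.Perm E := D.rotB⁻¹ * D.rotW

open Classical in
/-- The winding number of the zigzag path of `e`: the sum of the displacements along its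
edges, which are traversed as `x` from black to white and then `rotW x` from white to black. -/
noncomputable def winding [Fintype E] (e : E) : ℤ × ℤ :=
  ∑ x with D.zigzag.SameCycle e x, (D.disp (D.rotW x) - D.disp x)

/-- The direction of the winding number of the zigzag path of `e`. -/
noncomputable def windingDir [Fintype E] (e : E) : Real.Angle := direction (D.winding e)

open Classical in
/-- The edges at a white node. -/
noncomputable def edgesW [Fintype E] (v : W) : Finset E := {e | D.white e = v}

open Classical in
/-- The edges at a black node. -/
noncomputable def edgesB [Fintype E] (v : B) : Finset E := {e | D.black e = v}

/-- The node with edges `S`, cyclically permuted counterclockwise by `ρ`, is properly ordered: no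
zigzag path through it has winding zero, two zigzag paths that cross at one of its edges have
different winding directions, and the zigzag paths around it, counterclockwise starting from any
of them, come in strictly increasing counterclockwise order of their winding directions. -/
def OrderedAround [Fintype E] (ρ : Equiv.Perm E) (S : Finset E) : Prop :=
  ∀ e ∈ S, D.winding e ≠ 0 ∧ D.windingDir (ρ⁻¹ e) ≠ D.windingDir e ∧
    ∀ i j : ℕ, i < j → j < S.card →
      ccwAngle (D.windingDir e) (D.windingDir ((ρ ^ i) e)) <
        ccwAngle (D.windingDir e) (D.windingDir ((ρ ^ j) e))

/-- A dimer is properly ordered if each of its nodes is. -/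
def ProperlyOrdered [Fintype E] : Prop :=
  (∀ v : W, D.OrderedAround D.rotW (D.edgesW v)) ∧
    ∀ v : B, D.OrderedAround D.rotB (D.edgesB v)

/-- A perfect matching: each node is an endpoint of exactly one edge of `M`. -/
def IsPerfectMatching (M : Finset E) : Prop :=
  (∀ v : W, ∃! e, e ∈ M ∧ D.white e = v) ∧ ∀ v : B, ∃! e, e ∈ M ∧ D.black e = v

/-- The ray of direction `r` does not point in the direction of any winding number. -/
def IsGenericRay [Fintype E] (r : Real.Angle) : Prop := ∀ e, D.windingDir e ≠ r

/-- `e` is the edge `e(v)` chosen by the ray `r` at a node with edges `S`, cyclically permuted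
counterclockwise by `ρ`: of the zigzag paths through the node, the one passing just before `e`
makes the smallest clockwise angle with `r`, and the one passing just after `e` makes
the smallest counterclockwise angle with `r`. -/
def IsChosen [Fintype E] (r : Real.Angle) (ρ : Equiv.Perm E) (S : Finset E) (e : E) : Prop :=
  e ∈ S ∧ ∀ x ∈ S, ccwAngle (D.windingDir (ρ⁻¹ e)) r ≤ ccwAngle (D.windingDir x) r ∧
    ccwAngle r (D.windingDir e) ≤ ccwAngle r (D.windingDir x)

open Classical in
/-- The set `M(r)` of the edges chosen by the ray `r` at the nodes. -/
noncomputable def rayMatching [Fintype E] (r : Real.Angle) : Finset E :=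
  {e | D.IsChosen r D.rotW (D.edgesW (D.white e)) e ∨
    D.IsChosen r D.rotB (D.edgesB (D.black e)) e}

/-- `a e` is the number of times that some closed curve of winding number `u` crosses `e` with the
white endpoint on its left minus the number of times it does so with the white endpoint on its
right.  The crossing numbers of a closed curve on the torus with the cycles of the graph are given
by the exterior product of the winding numbers, which determines `a` up to
a coboundary; moving the curve across a node realizes every coboundary. -/
def IsCrossingNumber (u : ℤ × ℤ) (a : E → ℤ) : Prop :=
  ∃ (f : W → ℤ) (g : B → ℤ), ∀ e, a e = wedge (D.disp e) u + g (D.black e) - f (D.white e)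

open Classical in
/-- The Kasteleyn matrix, with entries in the Laurent polynomials in two variables: the edge `e` has
the weight `c e * w ^ (a e) * z ^ (b e)`. -/
noncomputable def kasteleyn [Fintype E] (c : E → ℂ) (a b : E → ℤ) :
    Matrix W B (AddMonoidAlgebra ℂ (ℤ × ℤ)) :=
  fun v v' => ∑ e with D.white e = v ∧ D.black e = v', AddMonoidAlgebra.single (a e, b e) (c e)

open Classical in
/-- The toric diagram: the Newton polygon of the determinant of the Kasteleyn matrix.  To take the
determinant, the rows are matched with the columns by a bijection; another choice changes
the determinant at most by a sign. (If there is no bijection, the diagram is empty.) -/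
noncomputable def toricDiagram [Fintype W] [Fintype E] (c : E → ℂ) (a b : E → ℤ) : Set (ℝ × ℝ) :=
  convexHull ℝ {x | ∃ φ : W ≃ B, ∃ p : ℤ × ℤ,
    ((D.kasteleyn c a b).submatrix id φ).det.coeff p ≠ 0 ∧ x = ((p.1 : ℝ), (p.2 : ℝ))}

/-- The point of the toric diagram that corresponds to `M`: the exponent of the product of the
weights of the edges of `M`. -/
def matchingPoint (a b : E → ℤ) (M : Finset E) : ℝ × ℝ :=
  (((∑ e ∈ M, a e : ℤ) : ℝ), ((∑ e ∈ M, b e : ℤ) : ℝ))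

end TorusDimer

/-! Zigzag paths turn counterclockwise at white nodes and clockwise at black ones, so they cross
every edge with its white endpoint on the left. The number of edges of a matching `M` that a union
`S` of zigzag paths crosses is therefore a homological intersection number. For two perfect
matchings these numbers differ by the exterior product of the difference of the homology classes
with the winding number of `S` (`exists_crossings_eq`, `totalCrossings_sub`). Moreover `M` crosses
`S` at most `S.card` times, since the two edges of a turn share a node. In case of equality `M`
contains every other edge of each path in `S`, and switching such a path to its other edges moves
the class of `M` by its winding number.

For a ray of angle `t`, take the winding angles in `[t, t + 2π)`. By proper ordering they drop at
exactly one edge around each node, and both endpoints of an edge see the same drop. So these edges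
form a perfect matching `descents t`, which is M(R) when the ray is generic. It attains the bound
for the paths of the smallest angle and for those of the largest one. This confines the class of any
other matching, relative to `descents t`, to a cone cut out by two inequalities. Since all windings
add up to zero, the directions lie in no open half plane, so the ray is a positive combination of
the two extreme directions, unless all directions are two opposite ones, a case treated apart.

A matching homologous to `descents t` is equal to it (`eq_descents_of_totalDisp_eq`). It must
contain the edges of the first level, for otherwise a switch would violate the bound for the last
direction. Switching the first level in both matchings turns the ray past this direction; repeating
this brings every edge to the first level. It follows that `descents t` is the strict maximum, among
perfect matchings, of the functional given by a generic ray (`wedge_ray_neg`).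

A corner of the diagram is the unique maximum of a generic functional on the exponents that occur,
and this functional comes from a generic ray. The monomial of the matching of this ray arises from
no other matching, so it cannot cancel in the determinant. Its exponent is thus in the diagram and
must be the corner. -/

/-! ### First cohomology of the torus, from the combinatorial map. -/

namespace TorusMap

variable {E : Type*} [Fintype E] (T : TorusMap E)

/-- The first coordinate of `disp`, as a rational cochain. -/
def dispFst (e : E) : ℚ := (T.disp e).1
/-- The second coordinate of `disp`, as a rational cochain. -/
def dispSnd (e : E) : ℚ := (T.disp e).2
/-- The first coordinate of `corner`. -/
def cornerFst (e : E) : ℚ := (T.corner e).1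
/-- The second coordinate of `corner`. -/
def cornerSnd (e : E) : ℚ := (T.corner e).2

/-- The cochain `φ`, developed along the faces by `c`, is closed. -/
def IsClosed (φ c : E → ℚ) : Prop :=
  ∀ e, c (T.rotW⁻¹ (T.rotB⁻¹ e)) = c e + φ e - φ (T.rotB⁻¹ e)

/-- Twice the cup product of two closed cochains, evaluated on the torus. -/
def cup (φ c φ' c' : E → ℚ) : ℚ :=
  ∑ e, (c e * φ' e - c' e * φ e - (c e + φ e) * φ' (T.rotB⁻¹ e)
    + (c' e + φ' e) * φ (T.rotB⁻¹ e))

theorem isClosed_dispFst : T.IsClosed T.dispFst T.cornerFst := fun e => by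
  rw [dispFst, cornerFst, cornerFst, dispFst, T.corner_next]
  push_cast [Prod.fst_add, Prod.fst_sub]
  rfl

theorem isClosed_dispSnd : T.IsClosed T.dispSnd T.cornerSnd := fun e => by
  rw [dispSnd, cornerSnd, cornerSnd, dispSnd, T.corner_next]
  push_cast [Prod.snd_add, Prod.snd_sub]
  rfl

theorem cup_disp : T.cup T.dispFst T.cornerFst T.dispSnd T.cornerSnd = 2 := by
  have h := congrArg (Int.cast : ℤ → ℚ) T.area
  simp only [wedge, Int.cast_sum, Prod.fst_add, Prod.snd_add] at h
  push_cast at h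
  rw [← h, cup]
  refine Finset.sum_congr rfl fun e _ => ?_
  simp only [dispFst, dispSnd, cornerFst, cornerSnd]
  ring

theorem cup_swap (φ c φ' c' : E → ℚ) : T.cup φ' c' φ c = -T.cup φ c φ' c' := by
  rw [cup, cup, ← Finset.sum_neg_distrib]
  exact Finset.sum_congr rfl fun e _ => by ring

theorem cup_self (φ c : E → ℚ) : T.cup φ c φ c = 0 := by
  have := T.cup_swap φ c φ c
  linarith

theorem cup_combination (φ c φ₁ c₁ φ₂ c₂ φ' c' : E → ℚ) (x y : ℚ) :
    T.cup (φ + x • φ₁ + y • φ₂) (c + x • c₁ + y • c₂) φ' c' =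
      T.cup φ c φ' c' + x * T.cup φ₁ c₁ φ' c' + y * T.cup φ₂ c₂ φ' c' := by
  simp only [cup, Finset.mul_sum, ← Finset.sum_add_distrib]
  refine Finset.sum_congr rfl fun e _ => ?_
  simp only [Pi.add_apply, Pi.smul_apply, smul_eq_mul]
  ring

theorem sum_face (h : E → ℚ) : ∑ e, h (T.rotW⁻¹ (T.rotB⁻¹ e)) = ∑ e, h e :=
  Equiv.sum_comp (T.rotW⁻¹ * T.rotB⁻¹) h

/-- The cup product vanishes on coboundaries. -/
theorem cup_coboundary {f g k φ' c' : E → ℚ} (hf : ∀ e, f (T.rotW⁻¹ e) = f e)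
    (hg : ∀ e, g (T.rotB⁻¹ e) = g e) (hk : ∀ e, k (T.rotW⁻¹ (T.rotB⁻¹ e)) = k e)
    (hc' : T.IsClosed φ' c') : T.cup (g - f) (f + k) φ' c' = 0 := by
  have e1 := T.sum_face (fun e => c' e * f e)
  have e2 := Equiv.sum_comp (T.rotB⁻¹) (fun e => φ' e * f e)
  have e3 := Equiv.sum_comp (T.rotB⁻¹) (fun e => φ' e * g e)
  have e4 := T.sum_face (fun e => c' e * k e)
  -- Four differences, each of which vanishes on reindexing its sum along the faces or around the
  -- black nodes.
  have key : T.cup (g - f) (f + k) φ' c' =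
      (∑ e, c' e * f e - ∑ e, c' (T.rotW⁻¹ (T.rotB⁻¹ e)) * f (T.rotW⁻¹ (T.rotB⁻¹ e)))
      + (∑ e, φ' e * f e - ∑ e, φ' (T.rotB⁻¹ e) * f (T.rotB⁻¹ e))
      + (∑ e, φ' e * g e - ∑ e, φ' (T.rotB⁻¹ e) * g (T.rotB⁻¹ e))
      + (∑ e, c' (T.rotW⁻¹ (T.rotB⁻¹ e)) * k (T.rotW⁻¹ (T.rotB⁻¹ e)) - ∑ e, c' e * k e) := by
    simp only [cup, ← Finset.sum_sub_distrib, ← Finset.sum_add_distrib]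
    refine Finset.sum_congr rfl fun e _ => ?_
    simp only [Pi.add_apply, Pi.sub_apply, hf, hg, hk, hc' e]
    ring
  rw [key, e1, e2, e3, e4]
  ring

theorem exists_eq_const {h : E → ℚ} (hW : ∀ e, h (T.rotW e) = h e)
    (hB : ∀ e, h (T.rotB e) = h e) : ∃ x, ∀ e, h e = x := by
  rcases isEmpty_or_nonempty E with hE | ⟨⟨e₀⟩⟩
  · exact ⟨0, fun e => isEmptyElim e⟩
  refine ⟨h e₀, fun e => ?_⟩
  obtain ⟨g, hg, rfl⟩ := T.connected e₀ e
  have : ∀ g ∈ Subgroup.closure {T.rotW, T.rotB}, ∀ e, h (g e) = h e := by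
    intro g hg
    induction hg using Subgroup.closure_induction with
    | mem x hx => rcases hx with rfl | rfl <;> assumption
    | one => simp
    | mul x y _ _ hx hy => intro e; rw [Equiv.Perm.mul_apply, hx, hy]
    | inv x _ hx => intro e; rw [← hx (x⁻¹ e)]; simp
  exact this g hg e₀

/-- The cycles of a permutation. -/
abbrev Cycles {E : Type*} (σ : Equiv.Perm E) : Type _ := Quotient (Equiv.Perm.SameCycle.setoid σ)

theorem mk_apply {E : Type*} (σ : Equiv.Perm E) (e : E) : (⟦σ e⟧ : Cycles σ) = ⟦e⟧ :=
  Quotient.sound (s := Equiv.Perm.SameCycle.setoid σ) (by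
    change σ.SameCycle (σ e) e
    exact Equiv.Perm.sameCycle_apply_left.2 (Equiv.Perm.SameCycle.refl _ _))

theorem mk_inv_apply {E : Type*} (σ : Equiv.Perm E) (e : E) : (⟦σ⁻¹ e⟧ : Cycles σ) = ⟦e⟧ :=
  Quotient.sound (s := Equiv.Perm.SameCycle.setoid σ) (by
    change σ.SameCycle (σ⁻¹ e) e
    exact ⟨1, by simp⟩)

/-- The coboundaries of vertex functions, with the freedom in the choice of the corners. -/
def coboundaryMap : (Cycles T.rotW → ℚ) × (Cycles T.rotB → ℚ) ×
    (Cycles (T.rotW⁻¹ * T.rotB⁻¹) → ℚ) →ₗ[ℚ] (E → ℚ) × (E → ℚ) where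
  toFun x := (fun e => x.2.1 ⟦e⟧ - x.1 ⟦e⟧, fun e => x.1 ⟦e⟧ + x.2.2 ⟦e⟧)
  map_add' x y := by ext e <;> simp <;> ring
  map_smul' r x := by ext e <;> simp <;> ring

/-- In the kernel `f = g = -k`, and by connectedness a function constant around both kinds of nodes
is constant. -/
theorem finrank_ker_coboundaryMap : Module.finrank ℚ (LinearMap.ker T.coboundaryMap) ≤ 1 := by
  have hle : LinearMap.ker T.coboundaryMap ≤
      Submodule.span ℚ {((1 : Cycles T.rotW → ℚ), (1 : Cycles T.rotB → ℚ),
        (-1 : Cycles (T.rotW⁻¹ * T.rotB⁻¹) → ℚ))} := by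
    rintro ⟨f, g, k⟩ hx
    rw [LinearMap.mem_ker] at hx
    have h1 : ∀ e : E, g ⟦e⟧ = f ⟦e⟧ := fun e =>
      sub_eq_zero.1 (congrFun (congrArg Prod.fst hx) e)
    have h2 : ∀ e : E, k ⟦e⟧ = -f ⟦e⟧ := fun e =>
      eq_neg_of_add_eq_zero_right (congrFun (congrArg Prod.snd hx) e)
    obtain ⟨r, hr⟩ := T.exists_eq_const (h := fun e => f ⟦e⟧)
      (fun e => by rw [mk_apply]) (fun e => by rw [← h1, ← h1, mk_apply])
    rw [Submodule.mem_span_singleton]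
    refine ⟨r, ?_⟩
    ext q
    · induction q using Quotient.inductionOn with | h e => simp [hr e]
    · induction q using Quotient.inductionOn with | h e => simp [h1 e, hr e]
    · induction q using Quotient.inductionOn with | h e => simp [h2 e, hr e]
  exact (Submodule.finrank_mono hle).trans (finrank_span_le_card _ |>.trans (by simp))

/-- The source has as many dimensions as there are vertices and faces, which is the number of edges
because the Euler characteristic is zero; at most one dimension is lost. -/
theorem finrank_range_coboundaryMap :
    Fintype.card E ≤ Module.finrank ℚ (LinearMap.range T.coboundaryMap) + 1 := by
  classical
  have h1 := LinearMap.finrank_range_add_finrank_ker T.coboundaryMap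
  have h2 := T.finrank_ker_coboundaryMap
  have h3 := T.euler
  change (Nat.card (Cycles T.rotW) : ℤ) + (Nat.card (Cycles T.rotB) : ℤ) - _
    + (Nat.card (Cycles (T.rotW⁻¹ * T.rotB⁻¹)) : ℤ) = 0 at h3
  have hfin : ∀ σ : Equiv.Perm E, Module.finrank ℚ (Cycles σ → ℚ) = Nat.card (Cycles σ) :=
    fun σ => by
      have : Fintype (Cycles σ) := Fintype.ofFinite _
      rw [Module.finrank_fintype_fun_eq_card, Nat.card_eq_fintype_card]
  rw [Module.finrank_prod, Module.finrank_prod, hfin, hfin, hfin] at h1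
  omega

/-- Its kernel consists of the closed cochains that have cup product zero with `disp`. -/
def obstructionMap : (E → ℚ) × (E → ℚ) →ₗ[ℚ] (E → ℚ) × ℚ × ℚ where
  toFun z := (fun e => z.2 (T.rotW⁻¹ (T.rotB⁻¹ e)) - z.2 e - z.1 e + z.1 (T.rotB⁻¹ e),
    T.cup z.1 z.2 T.dispFst T.cornerFst, T.cup z.1 z.2 T.dispSnd T.cornerSnd)
  map_add' x y := by
    refine Prod.ext (by ext e; simp; ring) (Prod.ext ?_ ?_)
    all_goals
      simp only [cup, Prod.fst_add, Prod.snd_add, ← Finset.sum_add_distrib]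
      refine Finset.sum_congr rfl fun e _ => ?_
      simp only [Pi.add_apply]
      ring
  map_smul' r x := by
    refine Prod.ext (by ext e; simp; ring) (Prod.ext ?_ ?_)
    all_goals
      simp only [cup, Prod.smul_fst, Prod.smul_snd, smul_eq_mul, Finset.mul_sum, RingHom.id_apply]
      refine Finset.sum_congr rfl fun e _ => ?_
      simp only [Pi.smul_apply, smul_eq_mul]
      ring

/-- A lower bound for the rank of `obstructionMap`: the only relation, up to scalars, is that the
closure defects of all faces add up to zero. -/
theorem finrank_ker_dualMap_obstructionMap :
    Module.finrank ℚ (LinearMap.ker T.obstructionMap.dualMap) ≤ 1 := by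
  classical
  let s : Module.Dual ℚ ((E → ℚ) × ℚ × ℚ) := (∑ e, LinearMap.proj e) ∘ₗ LinearMap.fst ℚ _ _
  have hle : LinearMap.ker T.obstructionMap.dualMap ≤ Submodule.span ℚ {s} := by
    intro L hL
    have hL : ∀ z, L (T.obstructionMap z) = 0 := fun z =>
      LinearMap.congr_fun (LinearMap.mem_ker.1 hL) z
    -- The coordinates of `disp` are closed and dual to each other under the cup product, so any
    -- relation ignores the two cup product components.
    have o1 : T.obstructionMap (T.dispFst, T.cornerFst) = (0, 0, 2) := by
      refine Prod.ext (funext fun e => ?_) (Prod.ext (T.cup_self _ _) T.cup_disp)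
      simp only [obstructionMap, LinearMap.coe_mk, AddHom.coe_mk, T.isClosed_dispFst e,
        Pi.zero_apply]
      ring
    have o2 : T.obstructionMap (T.dispSnd, T.cornerSnd) = (0, -2, 0) := by
      refine Prod.ext (funext fun e => ?_) (Prod.ext ?_ (T.cup_self _ _))
      · simp only [obstructionMap, LinearMap.coe_mk, AddHom.coe_mk, T.isClosed_dispSnd e,
          Pi.zero_apply]
        ring
      · change T.cup _ _ _ _ = -2
        rw [cup_swap, cup_disp]
    have l1 : L (0, 0, 1) = 0 := by
      have : ((0 : E → ℚ), (0 : ℚ), (1 : ℚ)) = (1 / 2 : ℚ) • ((0 : E → ℚ), (0 : ℚ), (2 : ℚ)) := by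
        simp
      rw [this, map_smul, ← o1, hL, smul_zero]
    have l2 : L (0, 1, 0) = 0 := by
      have : ((0 : E → ℚ), (1 : ℚ), (0 : ℚ)) = (-1 / 2 : ℚ) • ((0 : E → ℚ), (-2 : ℚ), (0 : ℚ)) := by
        norm_num
      rw [this, map_smul, ← o2, hL, smul_zero]
    have hdec : ∀ x : (E → ℚ) × ℚ × ℚ, L x = L (x.1, 0, 0) := by
      intro x
      have : x = (x.1, 0, 0) + x.2.1 • ((0 : E → ℚ), (1 : ℚ), (0 : ℚ))
          + x.2.2 • ((0 : E → ℚ), (0 : ℚ), (1 : ℚ)) := by ext <;> simp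
      conv_lhs => rw [this]
      rw [map_add, map_add, map_smul, map_smul, l1, l2]
      simp
    let h : E → ℚ := fun e => L (Pi.single e 1, 0, 0)
    -- Moving one corner makes `h` constant along faces; changing the cochain on one edge makes it
    -- constant around black nodes. Together they generate the white rotation.
    have hF : ∀ e, h (T.rotW⁻¹ (T.rotB⁻¹ e)) = h e := by
      intro e
      have h0 := hL (0, Pi.single (T.rotW⁻¹ (T.rotB⁻¹ e)) 1)
      rw [hdec] at h0
      have : (T.obstructionMap (0, Pi.single (T.rotW⁻¹ (T.rotB⁻¹ e)) 1)).1 =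
          Pi.single e 1 - Pi.single (T.rotW⁻¹ (T.rotB⁻¹ e)) 1 := by
        funext x
        simp [obstructionMap, Pi.single_apply]
      rw [this] at h0
      have e2 : ((Pi.single e 1 - Pi.single (T.rotW⁻¹ (T.rotB⁻¹ e)) 1 : E → ℚ), (0 : ℚ), (0 : ℚ)) =
        (Pi.single e 1, 0, 0) - (Pi.single (T.rotW⁻¹ (T.rotB⁻¹ e)) 1, 0, 0) := by simp
      rw [e2, map_sub, sub_eq_zero] at h0
      exact h0.symm
    have hB : ∀ e, h (T.rotB e) = h e := by
      intro e
      have h0 := hL (Pi.single e 1, 0)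
      rw [hdec] at h0
      have : (T.obstructionMap (Pi.single e 1, 0)).1 =
          Pi.single (T.rotB e) 1 - Pi.single e 1 := by
        funext x
        simp only [obstructionMap, LinearMap.coe_mk, AddHom.coe_mk, Pi.zero_apply, Pi.sub_apply,
          Pi.single_apply, Equiv.Perm.inv_eq_iff_eq]
        simp only [eq_comm (a := x)]
        ring
      rw [this] at h0
      have e2 : ((Pi.single (T.rotB e) 1 - Pi.single e 1 : E → ℚ), (0 : ℚ), (0 : ℚ)) =
        (Pi.single (T.rotB e) 1, 0, 0) - (Pi.single e 1, 0, 0) := by simp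
      rw [e2, map_sub, sub_eq_zero] at h0
      exact h0
    have hW : ∀ e, h (T.rotW e) = h e := by
      intro e
      have h1 := hF (T.rotB (T.rotW e))
      rw [Equiv.Perm.inv_eq_iff_eq.2 rfl, Equiv.Perm.inv_eq_iff_eq.2 rfl, hB] at h1
      exact h1.symm
    obtain ⟨r, hr⟩ := T.exists_eq_const hW hB
    rw [Submodule.mem_span_singleton]
    refine ⟨r, LinearMap.ext fun x => ?_⟩
    rw [hdec x]
    have hx : (x.1, (0 : ℚ), (0 : ℚ)) = ∑ e, x.1 e • ((Pi.single e 1 : E → ℚ), (0 : ℚ), (0 : ℚ)) := by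
      ext e
      · simp [Prod.fst_sum, Finset.sum_apply, Pi.single_apply]
      · simp [Prod.snd_sum]
      · simp [Prod.snd_sum]
    rw [hx, map_sum]
    simp only [map_smul]
    change r • s x = ∑ e, x.1 e • h e
    simp [s, hr, Finset.mul_sum, mul_comm]
  exact (Submodule.finrank_mono hle).trans (finrank_span_le_card _ |>.trans (by simp))

/-- A closed cochain whose cup products with `disp` vanish is a coboundary. -/
theorem exists_potential {φ c : E → ℚ} (hc : T.IsClosed φ c)
    (h1 : T.cup φ c T.dispFst T.cornerFst = 0) (h2 : T.cup φ c T.dispSnd T.cornerSnd = 0) :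
    ∃ f g : E → ℚ, (∀ e, f (T.rotW e) = f e) ∧ (∀ e, g (T.rotB e) = g e) ∧
      ∀ e, φ e = g e - f e := by
  have hle : LinearMap.range T.coboundaryMap ≤ LinearMap.ker T.obstructionMap := by
    rintro _ ⟨⟨f, g, k⟩, rfl⟩
    have hf : ∀ e, f ⟦T.rotW⁻¹ e⟧ = f ⟦e⟧ := fun e => by rw [mk_inv_apply]
    have hg : ∀ e, g ⟦T.rotB⁻¹ e⟧ = g ⟦e⟧ := fun e => by rw [mk_inv_apply]
    have hk : ∀ e, k ⟦T.rotW⁻¹ (T.rotB⁻¹ e)⟧ = k ⟦e⟧ := fun e =>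
      congrArg k (mk_apply (T.rotW⁻¹ * T.rotB⁻¹) e)
    rw [LinearMap.mem_ker]
    refine Prod.ext (funext fun e => ?_) (Prod.ext ?_ ?_)
    · simp only [obstructionMap, coboundaryMap, LinearMap.coe_mk, AddHom.coe_mk, hf, hg, hk,
        Prod.fst_zero, Pi.zero_apply]
      ring
    · exact T.cup_coboundary (f := fun e => f ⟦e⟧) (g := fun e => g ⟦e⟧) (k := fun e => k ⟦e⟧)
        hf hg hk T.isClosed_dispFst
    · exact T.cup_coboundary (f := fun e => f ⟦e⟧) (g := fun e => g ⟦e⟧) (k := fun e => k ⟦e⟧)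
        hf hg hk T.isClosed_dispSnd
  -- With `n` edges the range has dimension at least `n - 1`, and the kernel at most `2n - (n + 1)`.
  have heq : LinearMap.range T.coboundaryMap = LinearMap.ker T.obstructionMap := by
    refine Submodule.eq_of_le_of_finrank_le hle ?_
    have a1 := LinearMap.finrank_range_add_finrank_ker T.obstructionMap
    have a2 := LinearMap.finrank_range_add_finrank_ker T.obstructionMap.dualMap
    have a3 := T.finrank_ker_dualMap_obstructionMap
    have a4 := T.finrank_range_coboundaryMap
    rw [LinearMap.finrank_range_dualMap_eq_finrank_range, Subspace.dual_finrank_eq] at a2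
    simp only [Module.finrank_prod, Module.finrank_fintype_fun_eq_card, Module.finrank_self]
      at a1 a2
    omega
  have hmem : (φ, c) ∈ LinearMap.ker T.obstructionMap := by
    rw [LinearMap.mem_ker]
    refine Prod.ext (funext fun e => ?_) (Prod.ext h1 h2)
    simp only [obstructionMap, LinearMap.coe_mk, AddHom.coe_mk, hc e, Prod.fst_zero,
      Pi.zero_apply]
    ring
  rw [← heq] at hmem
  obtain ⟨⟨f, g, k⟩, hx⟩ := hmem
  exact ⟨fun e => f ⟦e⟧, fun e => g ⟦e⟧, fun e => congrArg f (mk_apply _ e),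
    fun e => congrArg g (mk_apply _ e),
    fun e => (congrFun (congrArg Prod.fst hx) e).symm⟩

end TorusMap

/-! ### Sectors of the dimer, subdivided by the edges of the ambient map. -/

/-- The indicator of the sectors that follow the elements of `S`, on the elements of `X`. -/
theorem exists_sector_indicator {X E : Type*} (ρ : Equiv.Perm X) (ι : E ↪ X) (σ : Equiv.Perm E)
    (h : ∀ e, IsNextIn ρ (Set.range ι) (ι e) (ι (σ e))) (s : E → ℚ) (hs : ∀ e, s e = 0 ∨ s e = 1) :
    ∃ m : X → ℚ, (∀ e, m (ι e) = s e) ∧ (∀ e, m (ρ⁻¹ (ι (σ e))) = s e) ∧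
      ∀ t, t ∉ Set.range ι → m (ρ⁻¹ t) = m t := by
  classical
  -- `t` lies in a selected sector: it is reached from a selected `ι e` without meeting another
  -- element of the range.
  let P : X → Prop := fun t => ∃ e, s e = 1 ∧ ∃ j : ℕ, t = (ρ ^ j) (ι e) ∧
    ∀ i, 0 < i → i ≤ j → (ρ ^ i) (ι e) ∉ Set.range ι
  have h1 : ∀ e, P (ι e) ↔ s e = 1 := by
    intro e
    refine ⟨?_, fun he => ⟨e, he, 0, by simp, by omega⟩⟩
    rintro ⟨x, hx, j, hj, hj'⟩
    rcases Nat.eq_zero_or_pos j with rfl | hpos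
    · rw [pow_zero, Equiv.Perm.one_apply] at hj
      rwa [ι.injective hj]
    · exact absurd ⟨e, hj⟩ (hj' j hpos le_rfl)
  have h2 : ∀ t, t ∉ Set.range ι → (P (ρ⁻¹ t) ↔ P t) := by
    intro t ht
    constructor
    · rintro ⟨x, hx, j, hj, hj'⟩
      have hjt : (ρ ^ (j + 1)) (ι x) = t := by
        rw [pow_succ', Equiv.Perm.mul_apply, ← hj]; simp
      refine ⟨x, hx, j + 1, hjt.symm, fun i hi hij => ?_⟩
      rcases Nat.lt_or_ge j i with hlt | hle
      · rw [show i = j + 1 by omega, hjt]; exact ht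
      · exact hj' i hi hle
    · rintro ⟨x, hx, j, hj, hj'⟩
      rcases j with _ | j
      · exact absurd ⟨x, by simpa using hj.symm⟩ ht
      · refine ⟨x, hx, j, ?_, fun i hi hij => hj' i hi (by omega)⟩
        rw [Equiv.Perm.inv_eq_iff_eq, hj, pow_succ', Equiv.Perm.mul_apply]
  refine ⟨fun t => if P t then 1 else 0, fun e => ?_, fun e => ?_, fun t ht => ?_⟩
  · rcases hs e with he | he <;> simp [h1, he]
  · obtain ⟨-, k, hk, hke, hkj⟩ := h e
    have h3 : ∀ i, i < k → (P ((ρ ^ i) (ι e)) ↔ s e = 1) := by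
      intro i
      induction i with
      | zero => intro _; simpa using h1 e
      | succ i ih =>
        intro hi
        rw [← ih (by omega), ← h2 _ (hkj (i + 1) (by omega) hi), pow_succ', Equiv.Perm.mul_apply]
        simp
    have h4 : ρ⁻¹ (ι (σ e)) = (ρ ^ (k - 1)) (ι e) := by
      rw [Equiv.Perm.inv_eq_iff_eq, ← hke, ← Equiv.Perm.mul_apply, ← pow_succ',
        show k - 1 + 1 = k by omega]
    rw [h4]
    simp only [h3 (k - 1) (by omega)]
    rcases hs e with he | he <;> simp [he]
  · simp only [h2 t ht]

/-- Displacements along the sectors add up to displacements from an element to the next. -/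
theorem sum_sector {X E : Type*} [Fintype X] [Fintype E] {ρ : Equiv.Perm X} {ι : E ↪ X}
    {σ : Equiv.Perm E} {s : E → ℚ} {m : X → ℚ} (h1 : ∀ e, m (ι e) = s e)
    (h2 : ∀ e, m (ρ⁻¹ (ι (σ e))) = s e) (h3 : ∀ t, t ∉ Set.range ι → m (ρ⁻¹ t) = m t)
    (δ : X → ℚ) :
    ∑ t, m t * (δ (ρ t) - δ t) = ∑ e, s e * (δ (ι (σ e)) - δ (ι e)) := by
  classical
  -- Summation by parts: the differences of `m` live only on the range of `ι`.
  have a1 : ∑ t, m t * δ (ρ t) = ∑ t, m (ρ⁻¹ t) * δ t := by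
    rw [← Equiv.sum_comp ρ (fun t => m (ρ⁻¹ t) * δ t)]
    exact Finset.sum_congr rfl fun t _ => by simp
  have a2 : ∑ e, s e * δ (ι (σ e)) = ∑ e, m (ρ⁻¹ (ι e)) * δ (ι e) := by
    rw [← Equiv.sum_comp σ (fun e => m (ρ⁻¹ (ι e)) * δ (ι e))]
    exact Finset.sum_congr rfl fun t _ => by rw [h2]
  simp only [mul_sub, Finset.sum_sub_distrib, a1, a2]
  rw [← Finset.sum_sub_distrib, ← Finset.sum_sub_distrib]
  have a3 : ∀ t ∉ Finset.univ.map ι, m (ρ⁻¹ t) * δ t - m t * δ t = 0 := by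
    intro t ht
    rw [h3 t (by simpa using ht), sub_self]
  rw [← Finset.sum_subset (Finset.subset_univ (Finset.univ.map ι)) fun t _ ht => a3 t ht,
    Finset.sum_map]
  simp only [h1]

theorem isNextIn_invariant {X E Y : Type*} {ρ : Equiv.Perm X} {ι : E ↪ X} {σ : Equiv.Perm E}
    (h : ∀ e, IsNextIn ρ (Set.range ι) (ι e) (ι (σ e))) {f : X → Y} (hf : ∀ t, f (ρ t) = f t)
    (e : E) : f (ι (σ e)) = f (ι e) := by
  obtain ⟨-, k, -, hk, -⟩ := h e
  rw [← hk]
  clear hk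
  induction k with
  | zero => simp
  | succ k ih => rw [pow_succ', Equiv.Perm.mul_apply, hf, ih]

/-! ### Intersection numbers of zigzag paths with edges. -/

namespace TorusDimer

variable {W B E : Type*} (D : TorusDimer W B E)

/-- The total displacement along the zigzag paths that make up `S`. -/
def shift (S : Finset E) : ℤ × ℤ := ∑ x ∈ S, (D.disp (D.rotW x) - D.disp x)

/-- A set of edges that is a union of zigzag paths. -/
def IsZigzagUnion (S : Finset E) : Prop := ∀ x, D.zigzag x ∈ S ↔ x ∈ S

open Classical in
/-- The number of times that the zigzag paths that make up `S` cross the edge `e`. -/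
noncomputable def crossings (S : Finset E) (e : E) : ℤ :=
  (if e ∈ S then 1 else 0) + (if D.rotW⁻¹ e ∈ S then 1 else 0)

theorem zigzag_rotW_inv (e : E) : D.zigzag (D.rotW⁻¹ e) = D.rotB⁻¹ e := by
  simp [zigzag]

theorem rotB_zigzag (e : E) : D.rotB (D.zigzag e) = D.rotW e := by
  simp [zigzag]

theorem sum_zigzag_image {S : Finset E} (hS : D.IsZigzagUnion S) (δ : E → ℚ) :
    ∑ e ∈ S, δ (D.zigzag e) = ∑ e ∈ S, δ e := by
  refine Finset.sum_equiv D.zigzag (fun x => (hS x).symm) fun x _ => rfl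

/-- The crossing numbers of a union of zigzag paths are given by its winding number, up to a
coboundary. -/
theorem exists_crossings_eq [Fintype E] {S : Finset E} (hS : D.IsZigzagUnion S) :
    ∃ f g : E → ℚ, (∀ e, f (D.rotW e) = f e) ∧ (∀ e, g (D.rotB e) = g e) ∧
      ∀ e, (D.crossings S e : ℚ) = wedge (D.disp e) (D.shift S) + g e - f e := by
  classical
  obtain ⟨n, T, ι, hd, hW, hB⟩ := D.embedded
  let s : E → ℚ := fun e => if e ∈ S then 1 else 0
  have hs : ∀ e, s e = 0 ∨ s e = 1 := fun e => by by_cases he : e ∈ S <;> simp [s, he]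
  obtain ⟨m, m1, m2, m3⟩ := exists_sector_indicator T.rotW ι D.rotW hW s hs
  obtain ⟨k, k1, k2, k3⟩ := exists_sector_indicator T.rotB ι D.rotB hB s hs
  -- The number of times that the zigzag paths, drawn close to the nodes of the ambient map, cross
  -- the edge `t`. On edges of the dimer this is `crossings`.
  let ψ : Fin n → ℚ := fun t => m t + k (T.rotB⁻¹ t)
  have hsz : ∀ e, s (D.rotB⁻¹ e) = s (D.rotW⁻¹ e) := fun e => by
    have h : D.zigzag (D.rotW⁻¹ e) ∈ S ↔ D.rotW⁻¹ e ∈ S := hS _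
    simp only [s, ← D.zigzag_rotW_inv e, h]
  have k2' : ∀ e, k (T.rotB⁻¹ (ι e)) = s (D.rotW⁻¹ e) := fun e => by
    rw [← hsz, ← k2 (D.rotB⁻¹ e)]; simp
  have m2' : ∀ e, m (T.rotW⁻¹ (ι e)) = s (D.rotW⁻¹ e) := fun e => by
    rw [← m2 (D.rotW⁻¹ e)]; simp
  have hψ : ∀ t, ψ t = m (T.rotW⁻¹ t) + k t := by
    intro t
    by_cases ht : t ∈ Set.range ι
    · obtain ⟨e, rfl⟩ := ht
      simp only [ψ, m1, k1, k2', m2']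
      ring
    · simp only [ψ, m3 t ht, k3 t ht]
  -- By `hψ`, crossings may be counted with the sectors on either side of the edge; comparing the
  -- two counts shows that `-m` develops `ψ`.
  have hclosed : T.IsClosed ψ (-m) := by
    intro e
    rw [hψ (T.rotB⁻¹ e)]
    simp only [ψ, Pi.neg_apply]
    ring
  -- Poincaré duality: the cup product with `ψ` is twice the integral of `δ` along the zigzag paths,
  -- one copy from the white turns and one from the black turns.
  have hcup : ∀ δ c : Fin n → ℚ, T.IsClosed δ c →
      T.cup ψ (-m) δ c = 2 * ∑ e ∈ S, (δ (ι (D.rotW e)) - δ (ι e)) := by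
    intro δ c hc
    have b1 := sum_sector m1 m2 m3 δ
    have b2 := sum_sector k1 k2 k3 δ
    have b3 : ∀ F : E → ℚ, ∑ e, s e * F e = ∑ e ∈ S, F e := fun F => by
      simp [s, Finset.sum_ite_mem]
    have b4 : ∑ e ∈ S, (δ (ι (D.rotB e)) - δ (ι e)) = ∑ e ∈ S, (δ (ι (D.rotW e)) - δ (ι e)) := by
      have c1 := D.sum_zigzag_image hS (fun e => δ (ι (D.rotB e)))
      have c2 := Finset.sum_congr rfl fun e (_ : e ∈ S) =>
        congrArg (fun x => δ (ι x)) (D.rotB_zigzag e)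
      rw [Finset.sum_sub_distrib, Finset.sum_sub_distrib, ← c1, c2]
    rw [b3] at b1 b2
    rw [b4] at b2
    have c1 := T.sum_face (fun t => m t * (c t + δ (T.rotW t)))
    have c2 := Equiv.sum_comp T.rotB⁻¹ (fun t => k t * (δ (T.rotB t) - δ t))
    rw [two_mul]
    nth_rw 1 [← b1]
    rw [← b2, ← c2]
    have key : ∑ t, m t * (δ (T.rotW t) - δ t) =
        ∑ t, m t * (c t + δ (T.rotW t)) - ∑ t, m t * (c t + δ t) := by
      rw [← Finset.sum_sub_distrib]
      exact Finset.sum_congr rfl fun t _ => by ring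
    rw [key, ← c1, ← Finset.sum_sub_distrib, ← Finset.sum_add_distrib]
    refine Finset.sum_congr rfl fun t _ => ?_
    have e1 : T.rotW (T.rotW⁻¹ (T.rotB⁻¹ t)) = T.rotB⁻¹ t := Equiv.Perm.inv_eq_iff_eq.1 rfl |>.symm
    have e2 : T.rotB (T.rotB⁻¹ t) = t := Equiv.Perm.inv_eq_iff_eq.1 rfl |>.symm
    rw [hψ (T.rotB⁻¹ t), e1, e2, hc t]
    simp only [ψ, Pi.neg_apply]
    ring
  have d1 : ∀ e, T.dispFst (ι e) = ((D.disp e).1 : ℚ) := fun e => by rw [TorusMap.dispFst, hd]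
  have d2 : ∀ e, T.dispSnd (ι e) = ((D.disp e).2 : ℚ) := fun e => by rw [TorusMap.dispSnd, hd]
  have w1 : T.cup ψ (-m) T.dispFst T.cornerFst = 2 * ((D.shift S).1 : ℚ) := by
    rw [hcup _ _ T.isClosed_dispFst]
    simp [d1, shift, Prod.fst_sum]
  have w2 : T.cup ψ (-m) T.dispSnd T.cornerSnd = 2 * ((D.shift S).2 : ℚ) := by
    rw [hcup _ _ T.isClosed_dispSnd]
    simp [d2, shift, Prod.snd_sum]
  -- Subtracting from `ψ` the cochain given by the exterior product of `disp` with the winding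
  -- number makes both cup products vanish.
  obtain ⟨f, g, hf, hg, hfg⟩ := T.exists_potential
    (φ := ψ + (-((D.shift S).2 : ℚ)) • T.dispFst + ((D.shift S).1 : ℚ) • T.dispSnd)
    (c := -m + (-((D.shift S).2 : ℚ)) • T.cornerFst + ((D.shift S).1 : ℚ) • T.cornerSnd)
    (fun e => by
      simp only [Pi.add_apply, Pi.smul_apply, smul_eq_mul, hclosed e, T.isClosed_dispFst e,
        T.isClosed_dispSnd e]
      ring)
    (by
      rw [T.cup_combination, w1, T.cup_self, T.cup_swap, T.cup_disp]
      ring)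
    (by
      rw [T.cup_combination, w2, T.cup_self, T.cup_disp]
      ring)
  refine ⟨fun e => f (ι e), fun e => g (ι e), isNextIn_invariant hW hf, isNextIn_invariant hB hg,
    fun e => ?_⟩
  have := hfg (ι e)
  simp only [Pi.add_apply, Pi.smul_apply, smul_eq_mul, d1, d2, ψ, m1, k2'] at this
  simp only [crossings, wedge]
  push_cast
  simp only [s] at this
  linarith

end TorusDimer

/-! ### Matchings: counting crossings and switching zigzag paths. -/

/-- `M` contains exactly one edge at each node. -/
def CoversOnce {E V : Type*} (node : E → V) (M : Finset E) : Prop :=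
  ∀ v, ∃! e, e ∈ M ∧ node e = v

namespace CoversOnce

variable {E V : Type*} {node : E → V} {M M' : Finset E}

theorem inj (h : CoversOnce node M) {x y : E} (hx : x ∈ M) (hy : y ∈ M)
    (hxy : node x = node y) : x = y :=
  (h (node y)).unique ⟨hx, hxy⟩ ⟨hy, rfl⟩

open Classical in
theorem flip (h : CoversOnce node M) {σ : Equiv.Perm E} (hσ : ∀ e, node (σ e) = node e)
    {P : Finset E} (hP : P ⊆ M) : CoversOnce node ((M \ P) ∪ P.image σ) := by
  intro v
  obtain ⟨e, ⟨heM, rfl⟩, -⟩ := h v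
  by_cases heP : e ∈ P
  · refine ⟨σ e, ⟨by simp [heP], hσ e⟩, ?_⟩
    rintro y ⟨hy, hyv⟩
    rw [Finset.mem_union, Finset.mem_sdiff, Finset.mem_image] at hy
    rcases hy with ⟨hyM, hyP⟩ | ⟨x, hx, rfl⟩
    · exact absurd (h.inj heM hyM hyv.symm ▸ heP) hyP
    · rw [hσ] at hyv
      rw [h.inj (hP hx) heM hyv]
  · refine ⟨e, ⟨by simp [heM, heP], rfl⟩, ?_⟩
    rintro y ⟨hy, hyv⟩
    rw [Finset.mem_union, Finset.mem_sdiff, Finset.mem_image] at hy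
    rcases hy with ⟨hyM, hyP⟩ | ⟨x, hx, rfl⟩
    · exact h.inj hyM heM hyv
    · rw [hσ] at hyv
      exact absurd (h.inj (hP hx) heM hyv ▸ hx) heP

open Classical in
theorem sum_flip (h : CoversOnce node M) {σ : Equiv.Perm E} (hσ : ∀ e, node (σ e) = node e)
    {P : Finset E} (hP : P ⊆ M) {A : Type*} [AddCommGroup A] (F : E → A) :
    ∑ e ∈ (M \ P) ∪ P.image σ, F e = ∑ e ∈ M, F e + ∑ e ∈ P, (F (σ e) - F e) := by
  have hdisj : Disjoint (M \ P) (P.image σ) := by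
    rw [Finset.disjoint_left]
    intro y hy hy'
    rw [Finset.mem_sdiff] at hy
    obtain ⟨x, hx, rfl⟩ := Finset.mem_image.1 hy'
    exact hy.2 (h.inj (hP hx) hy.1 (hσ x).symm ▸ hx)
  rw [Finset.sum_union hdisj, Finset.sum_image fun x _ y _ hxy => σ.injective hxy,
    Finset.sum_sub_distrib, ← Finset.sum_sdiff hP]
  abel

theorem sum_eq (h : CoversOnce node M) (h' : CoversOnce node M') {A : Type*} [AddCommMonoid A]
    {g : E → A} (hg : ∀ x y, node x = node y → g x = g y) : ∑ e ∈ M, g e = ∑ e ∈ M', g e := by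
  choose i hi using fun v => (h v).exists
  choose j hj using fun v => (h' v).exists
  refine Finset.sum_bij' (fun e _ => j (node e)) (fun e _ => i (node e)) (fun e _ => (hj _).1)
    (fun e _ => (hi _).1) (fun e he => ?_) (fun e he => ?_) fun e _ => hg _ _ (hj _).2.symm
  · exact inj h (hi _).1 he ((hi _).2.trans (hj _).2)
  · exact inj h' (hj _).1 he ((hj _).2.trans (hi _).2)

end CoversOnce

theorem apply_eq_of_sameCycle {E Y : Type*} {σ : Equiv.Perm E} {f : E → Y}
    (hf : ∀ e, f (σ e) = f e) {x y : E} (h : σ.SameCycle x y) : f x = f y := by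
  obtain ⟨i, rfl⟩ := h
  have h1 : ∀ (n : ℕ) (e : E), f ((σ ^ n) e) = f e := by
    intro n
    induction n with
    | zero => simp
    | succ n ih => intro e; rw [pow_succ', Equiv.Perm.mul_apply, hf, ih]
  obtain ⟨n, rfl | rfl⟩ := i.eq_nat_or_neg
  · rw [zpow_natCast, h1]
  · rw [zpow_neg, zpow_natCast, ← h1 n ((σ ^ n)⁻¹ x), ← Equiv.Perm.mul_apply, mul_inv_cancel,
      Equiv.Perm.one_apply]

namespace TorusDimer

variable {W B E : Type*} (D : TorusDimer W B E) {M M' S P : Finset E}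

theorem white_rotW (e : E) : D.white (D.rotW e) = D.white e :=
  ((D.sameCycle_rotW _ _).1 (Equiv.Perm.sameCycle_apply_left.2 (Equiv.Perm.SameCycle.refl _ _)))

theorem black_rotB (e : E) : D.black (D.rotB e) = D.black e :=
  ((D.sameCycle_rotB _ _).1 (Equiv.Perm.sameCycle_apply_left.2 (Equiv.Perm.SameCycle.refl _ _)))

theorem white_rotW_inv (e : E) : D.white (D.rotW⁻¹ e) = D.white e := by
  rw [← D.white_rotW (D.rotW⁻¹ e)]; simp

theorem black_rotB_inv (e : E) : D.black (D.rotB⁻¹ e) = D.black e := by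
  rw [← D.black_rotB (D.rotB⁻¹ e)]; simp

/-- The homology class of a set of edges, up to a constant that depends on the nodes only. -/
def totalDisp (M : Finset E) : ℤ × ℤ := ∑ e ∈ M, D.disp e

/-- The total number of crossings of the zigzag paths that make up `S` with edges of `M`. -/
noncomputable def totalCrossings (S M : Finset E) : ℤ := ∑ e ∈ M, D.crossings S e

/-- The coboundary terms sum to the same value over any perfect matching, as each node is covered
once. -/
theorem totalCrossings_sub [Fintype E] (hS : D.IsZigzagUnion S) (hM : D.IsPerfectMatching M)
    (hM' : D.IsPerfectMatching M') :
    D.totalCrossings S M - D.totalCrossings S M' =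
      wedge (D.totalDisp M - D.totalDisp M') (D.shift S) := by
  obtain ⟨f, g, hf, hg, hfg⟩ := D.exists_crossings_eq hS
  have e1 := CoversOnce.sum_eq hM.1 hM'.1 (g := f) fun x y h =>
    apply_eq_of_sameCycle hf ((D.sameCycle_rotW x y).2 h)
  have e2 := CoversOnce.sum_eq hM.2 hM'.2 (g := g) fun x y h =>
    apply_eq_of_sameCycle hg ((D.sameCycle_rotB x y).2 h)
  have key : ∀ N : Finset E, (D.totalCrossings S N : ℚ) =
      (wedge (D.totalDisp N) (D.shift S) : ℤ) + ∑ e ∈ N, g e - ∑ e ∈ N, f e := by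
    intro N
    simp only [totalCrossings, Int.cast_sum, hfg, Finset.sum_sub_distrib, Finset.sum_add_distrib]
    simp [wedge, totalDisp, Prod.fst_sum, Prod.snd_sum, Finset.sum_mul]
  have h := congrArg₂ (· - ·) (key M) (key M')
  simp only [e1, e2] at h
  have h2 : wedge (D.totalDisp M - D.totalDisp M') (D.shift S) =
      wedge (D.totalDisp M) (D.shift S) - wedge (D.totalDisp M') (D.shift S) := by
    simp only [wedge, Prod.fst_sub, Prod.snd_sub]
    ring
  rw [h2]
  have h3 : ((D.totalCrossings S M - D.totalCrossings S M' : ℤ) : ℚ) =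
      ((wedge (D.totalDisp M) (D.shift S) - wedge (D.totalDisp M') (D.shift S) : ℤ) : ℚ) := by
    push_cast
    linarith
  exact_mod_cast h3

open Classical in
theorem totalCrossings_eq (S M : Finset E) : D.totalCrossings S M =
    ∑ x ∈ S, ((if x ∈ M then 1 else 0) + (if D.rotW x ∈ M then 1 else 0) : ℤ) := by
  simp only [totalCrossings, crossings, Finset.sum_add_distrib, Finset.sum_boole]
  have h1 : {x ∈ M | x ∈ S} = {x ∈ S | x ∈ M} := by ext; simp [and_comm]
  have h2 : {x ∈ M | D.rotW⁻¹ x ∈ S}.card = {x ∈ S | D.rotW x ∈ M}.card :=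
    Finset.card_bij' (fun x _ => D.rotW⁻¹ x) (fun x _ => D.rotW x)
      (fun x hx => by simpa [and_comm] using hx) (fun x hx => by simpa [and_comm] using hx)
      (fun x _ => by simp) (fun x _ => by simp)
  rw [h1, h2]

/-- A matching contains at most one of the edges of a zigzag path at a white node. -/
theorem not_rotW_mem (hM : D.IsPerfectMatching M) {x : E} (hne : D.rotW x ≠ x) (hx : x ∈ M) :
    D.rotW x ∉ M :=
  fun h => hne (CoversOnce.inj hM.1 h hx (D.white_rotW x))

theorem not_rotB_mem (hM : D.IsPerfectMatching M) {x : E} (hne : D.rotB x ≠ x) (hx : x ∈ M) :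
    D.rotB x ∉ M :=
  fun h => hne (CoversOnce.inj hM.2 h hx (D.black_rotB x))

theorem totalCrossings_le (hM : D.IsPerfectMatching M) (hne : ∀ x, D.rotW x ≠ x) :
    D.totalCrossings S M ≤ S.card := by
  classical
  rw [totalCrossings_eq, Finset.card_eq_sum_ones, Nat.cast_sum]
  refine Finset.sum_le_sum fun x _ => ?_
  have := D.not_rotW_mem hM (hne x)
  by_cases h1 : x ∈ M
  · simp [h1, this h1]
  · by_cases h2 : D.rotW x ∈ M <;> simp [h1, h2]

theorem totalCrossings_eq_card_iff (hM : D.IsPerfectMatching M) (hne : ∀ x, D.rotW x ≠ x) :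
    D.totalCrossings S M = S.card ↔ ∀ x ∈ S, x ∈ M ∨ D.rotW x ∈ M := by
  classical
  rw [totalCrossings_eq, Finset.card_eq_sum_ones, Nat.cast_sum, Finset.sum_eq_sum_iff_of_le]
  · refine forall₂_congr fun x _ => ?_
    have := D.not_rotW_mem hM (hne x)
    by_cases h1 : x ∈ M
    · simp [h1, this h1]
    · by_cases h2 : D.rotW x ∈ M <;> simp [h1, h2]
  · intro x _
    have := D.not_rotW_mem hM (hne x)
    by_cases h1 : x ∈ M
    · simp [h1, this h1]
    · by_cases h2 : D.rotW x ∈ M <;> simp [h1, h2]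

open Classical in
-- Because of this, one switch can be read as `rotW` at the white nodes and as `rotB` at the black
-- nodes, so that it preserves both covering conditions.
theorem image_rotW_eq [Fintype E] (hP : D.IsZigzagUnion P) : P.image D.rotW = P.image D.rotB := by
  ext y
  simp only [Finset.mem_image]
  constructor
  · rintro ⟨x, hx, rfl⟩
    exact ⟨D.zigzag x, (hP x).2 hx, D.rotB_zigzag x⟩
  · rintro ⟨x, hx, rfl⟩
    refine ⟨D.zigzag⁻¹ x, (hP _).1 (by simpa using hx), ?_⟩
    rw [← D.rotB_zigzag]; simp

open Classical in
/-- Replace each edge of `P` by the next edge of its zigzag path. -/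
theorem isPerfectMatching_flip [Fintype E] (hM : D.IsPerfectMatching M) (hP : D.IsZigzagUnion P)
    (hPM : P ⊆ M) : D.IsPerfectMatching ((M \ P) ∪ P.image D.rotW) := by
  refine ⟨CoversOnce.flip hM.1 D.white_rotW hPM, ?_⟩
  rw [D.image_rotW_eq hP]
  exact CoversOnce.flip hM.2 D.black_rotB hPM

open Classical in
theorem totalDisp_flip (hM : D.IsPerfectMatching M) (hPM : P ⊆ M) :
    D.totalDisp ((M \ P) ∪ P.image D.rotW) = D.totalDisp M + D.shift P :=
  CoversOnce.sum_flip hM.1 D.white_rotW hPM D.disp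

open Classical in
/-- The reverse operation. -/
theorem isPerfectMatching_unflip [Fintype E] (hM : D.IsPerfectMatching M)
    (hP : D.IsZigzagUnion P) (hPM : P.image D.rotW ⊆ M) :
    D.IsPerfectMatching ((M \ P.image D.rotW) ∪ P) := by
  constructor
  · have := CoversOnce.flip hM.1 D.white_rotW_inv hPM
    rwa [Finset.image_image, show (⇑D.rotW⁻¹ ∘ ⇑D.rotW) = id from funext fun x => by simp,
      Finset.image_id] at this
  · have h := D.image_rotW_eq hP
    rw [h] at hPM ⊢
    have := CoversOnce.flip hM.2 D.black_rotB_inv hPM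
    rwa [Finset.image_image, show (⇑D.rotB⁻¹ ∘ ⇑D.rotB) = id from funext fun x => by simp,
      Finset.image_id] at this

open Classical in
theorem totalDisp_unflip (hM : D.IsPerfectMatching M) (hPM : P.image D.rotW ⊆ M) :
    D.totalDisp ((M \ P.image D.rotW) ∪ P) = D.totalDisp M - D.shift P := by
  have := CoversOnce.sum_flip hM.1 D.white_rotW_inv hPM D.disp
  rw [Finset.image_image, show (⇑D.rotW⁻¹ ∘ ⇑D.rotW) = id from funext fun x => by simp,
      Finset.image_id, Finset.sum_image fun x _ y _ hxy => D.rotW.injective hxy] at this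
  rw [totalDisp, this, totalDisp, shift, sub_eq_add_neg, ← Finset.sum_neg_distrib]
  simp

/-- If `M` has the maximal number of crossings with the zigzag paths that make up `S`, then
it contains every other edge of each of them. -/
theorem isZigzagUnion_filter [DecidableEq E] (hM : D.IsPerfectMatching M)
    (hB : ∀ x, D.rotB x ≠ x) (hS : D.IsZigzagUnion S)
    (hSM : ∀ x ∈ S, x ∈ M ∨ D.rotW x ∈ M) : D.IsZigzagUnion {x ∈ S | x ∈ M} := by
  have h1 : ∀ x ∈ S, x ∉ M → D.zigzag x ∉ M := fun x hx hxM h =>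
    D.not_rotB_mem hM (hB _) h (by
      rw [D.rotB_zigzag]; exact (hSM x hx).resolve_left hxM)
  have h2 : {x ∈ S | x ∉ M}.image D.zigzag ⊆ {x ∈ S | x ∉ M} := by
    intro y hy
    obtain ⟨x, hx, rfl⟩ := Finset.mem_image.1 hy
    rw [Finset.mem_filter] at hx ⊢
    exact ⟨(hS x).2 hx.1, h1 x hx.1 hx.2⟩
  -- An injective map of a finite set into itself is onto, which gives the converse implication.
  have h3 := Finset.eq_of_subset_of_card_le h2
    (Finset.card_image_of_injective _ D.zigzag.injective).ge
  intro x
  have h4 : D.zigzag x ∈ {x ∈ S | x ∉ M} ↔ x ∈ {x ∈ S | x ∉ M} := by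
    conv_lhs => rw [← h3]
    exact D.zigzag.injective.mem_finset_image
  have h5 : D.zigzag x ∈ S ↔ x ∈ S := hS x
  simp only [Finset.mem_filter, h5] at h4 ⊢
  tauto

end TorusDimer

/-! ### Winding angles seen from a ray, and the matching of a ray. -/

theorem ccwAngle_coe {x y : ℝ} (h1 : x ≤ y) (h2 : y < x + 2 * Real.pi) :
    ccwAngle (x : Real.Angle) (y : Real.Angle) = y - x := by
  rw [ccwAngle, ← Real.Angle.coe_sub, Real.Angle.toReal_coe, toIcoMod_toIocMod, toIcoMod_eq_self]
  constructor <;> linarith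

theorem ccwAngle_coe_of_lt {x y : ℝ} (h1 : y < x) (h2 : x ≤ y + 2 * Real.pi) :
    ccwAngle (x : Real.Angle) (y : Real.Angle) = y + 2 * Real.pi - x := by
  rw [← ccwAngle_coe (x := x) (y := y + 2 * Real.pi) h2 (by linarith)]
  simp

/-- If vectors with polar angles in an interval of length at most `π` have sum zero, then the
interval has length `π` and all the angles are at its ends. -/
theorem angles_of_sum_eq_zero {E : Type*} [Fintype E] [Nonempty E] {r α : E → ℝ} {m l : ℝ}
    (hr : ∀ e, 0 < r e) (hm : ∀ e, m ≤ α e) (hl : ∀ e, α e ≤ l)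
    (hcos : ∑ e, r e * Real.cos (α e) = 0) (hsin : ∑ e, r e * Real.sin (α e) = 0)
    (hlm : l - m ≤ Real.pi) : l - m = Real.pi ∧ ∀ e, α e = m ∨ α e = l := by
  -- Projected to the bisector of the interval, all vectors have nonnegative components, so every
  -- component is zero.
  have hsum : ∑ e, r e * Real.cos (α e - (m + l) / 2) = 0 := by
    have : ∀ e, r e * Real.cos (α e - (m + l) / 2) =
        r e * Real.cos (α e) * Real.cos ((m + l) / 2) +
          r e * Real.sin (α e) * Real.sin ((m + l) / 2) := fun e => by
      rw [Real.cos_sub]; ring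
    simp only [this, Finset.sum_add_distrib, ← Finset.sum_mul, hcos, hsin]
    ring
  have hnn : ∀ e ∈ Finset.univ, 0 ≤ r e * Real.cos (α e - (m + l) / 2) := fun e _ =>
    mul_nonneg (hr e).le (Real.cos_nonneg_of_mem_Icc
      ⟨by linarith [hm e], by linarith [hl e]⟩)
  have hzero := (Finset.sum_eq_zero_iff_of_nonneg hnn).1 hsum
  have hend : ∀ e, ¬ (-(Real.pi / 2) < α e - (m + l) / 2 ∧ α e - (m + l) / 2 < Real.pi / 2) := by
    intro e he
    exact (mul_pos (hr e) (Real.cos_pos_of_mem_Ioo he)).ne' (hzero e (Finset.mem_univ e))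
  have hcase : ∀ e, l - m = Real.pi ∧ (α e = m ∨ α e = l) := by
    intro e
    have h1 := hm e
    have h2 := hl e
    by_cases h : -(Real.pi / 2) < α e - (m + l) / 2
    · have h3 : Real.pi / 2 ≤ α e - (m + l) / 2 := not_lt.1 fun h' => hend e ⟨h, h'⟩
      exact ⟨by linarith, Or.inr (by linarith)⟩
    · exact ⟨by linarith, Or.inl (by linarith)⟩
  exact ⟨(hcase (Classical.arbitrary E)).1, fun e => (hcase e).2⟩

namespace TorusDimer

variable {W B E : Type*} [Fintype E] (D : TorusDimer W B E) (t : ℝ)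

/-- The polar angle of the winding number of the zigzag path of `e`. -/
noncomputable def windingArg (e : E) : ℝ :=
  Complex.arg ⟨((D.winding e).1 : ℝ), ((D.winding e).2 : ℝ)⟩

/-- The length of the winding number of the zigzag path of `e`. -/
noncomputable def windingNorm (e : E) : ℝ :=
  ‖(⟨((D.winding e).1 : ℝ), ((D.winding e).2 : ℝ)⟩ : ℂ)‖

/-- The polar angle in `[t, t + 2π)` of the winding number of the zigzag path of `e`. -/
noncomputable def windingAngle (e : E) : ℝ :=
  toIcoMod Real.two_pi_pos t (D.windingArg e)

theorem coe_windingAngle (e : E) : (D.windingAngle t e : Real.Angle) = D.windingDir e := by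
  rw [windingAngle, Real.Angle.coe_toIcoMod]
  rfl

theorem le_windingAngle (e : E) : t ≤ D.windingAngle t e :=
  left_le_toIcoMod Real.two_pi_pos t _

theorem windingAngle_lt (e : E) : D.windingAngle t e < t + 2 * Real.pi :=
  toIcoMod_lt_right Real.two_pi_pos t _

variable {t} in
theorem windingAngle_eq_of_coe {e : E} {x : ℝ} (h1 : t ≤ x) (h2 : x < t + 2 * Real.pi)
    (h : (x : Real.Angle) = D.windingDir e) : D.windingAngle t e = x := by
  rw [windingAngle, toIcoMod_eq_iff]
  refine ⟨⟨h1, h2⟩, ?_⟩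
  obtain ⟨k, hk⟩ := Real.Angle.angle_eq_iff_two_pi_dvd_sub.1 h.symm
  refine ⟨k, ?_⟩
  rw [zsmul_eq_mul]
  change D.windingArg e - x = _ at hk
  linarith

variable {t} in
theorem windingAngle_eq_iff {e e' : E} :
    D.windingAngle t e = D.windingAngle t e' ↔ D.windingDir e = D.windingDir e' := by
  constructor
  · intro h
    rw [← D.coe_windingAngle t e, h, coe_windingAngle]
  · intro h
    exact D.windingAngle_eq_of_coe (D.le_windingAngle t e') (D.windingAngle_lt t e')
      ((D.coe_windingAngle t e').trans h.symm)

theorem winding_fst (e : E) :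
    ((D.winding e).1 : ℝ) = D.windingNorm e * Real.cos (D.windingAngle t e) := by
  have h : Real.cos (D.windingAngle t e) = Real.cos (D.windingArg e) := by
    rw [← Real.Angle.cos_coe, coe_windingAngle, ← Real.Angle.cos_coe]
    rfl
  rw [h, windingNorm, windingArg, Complex.norm_mul_cos_arg]

theorem winding_snd (e : E) :
    ((D.winding e).2 : ℝ) = D.windingNorm e * Real.sin (D.windingAngle t e) := by
  have h : Real.sin (D.windingAngle t e) = Real.sin (D.windingArg e) := by
    rw [← Real.Angle.sin_coe, coe_windingAngle, ← Real.Angle.sin_coe]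
    rfl
  rw [h, windingNorm, windingArg, Complex.norm_mul_sin_arg]

theorem windingNorm_pos {e : E} (h : D.winding e ≠ 0) : 0 < D.windingNorm e := by
  rw [windingNorm, norm_pos_iff]
  intro h0
  refine h (Prod.ext ?_ ?_)
  · simpa using congrArg Complex.re h0
  · simpa using congrArg Complex.im h0

theorem winding_eq_of_sameCycle {x y : E} (h : D.zigzag.SameCycle x y) :
    D.winding x = D.winding y := by
  have : ∀ z, D.zigzag.SameCycle x z ↔ D.zigzag.SameCycle y z :=
    fun z => ⟨h.symm.trans, h.trans⟩
  unfold winding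
  congr 1
  ext z
  simp only [Finset.mem_filter, Finset.mem_univ, true_and]
  exact this z

theorem winding_zigzag (e : E) : D.winding (D.zigzag e) = D.winding e :=
  D.winding_eq_of_sameCycle (Equiv.Perm.sameCycle_apply_left.2 (Equiv.Perm.SameCycle.refl _ _))

theorem windingDir_zigzag (e : E) : D.windingDir (D.zigzag e) = D.windingDir e := by
  simp only [windingDir, winding_zigzag]

theorem windingAngle_zigzag (e : E) : D.windingAngle t (D.zigzag e) = D.windingAngle t e := by
  rw [windingAngle_eq_iff, windingDir_zigzag]

theorem windingAngle_rotB_inv (e : E) :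
    D.windingAngle t (D.rotB⁻¹ e) = D.windingAngle t (D.rotW⁻¹ e) := by
  rw [← zigzag_rotW_inv, windingAngle_zigzag]

/-- Around a properly ordered node there is exactly one edge where the polar angles of the zigzag
paths in `[t, t + 2π)` decrease. -/
theorem exists_unique_descent {ρ : Equiv.Perm E} {S : Finset E}
    (hS : ∀ e ∈ S, ρ e ∈ S ∧ ρ⁻¹ e ∈ S) 
    (hO : D.OrderedAround ρ S) (hne : S.Nonempty) :
    ∃ e ∈ S, (∀ x ∈ S, D.windingAngle t x < D.windingAngle t (ρ⁻¹ x) ↔ x = e) ∧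
      ∀ x ∈ S, D.windingAngle t e ≤ D.windingAngle t x ∧
        D.windingAngle t x ≤ D.windingAngle t (ρ⁻¹ e) := by
  classical
  -- Read from the smallest angle, the cyclic order becomes increasing, and the only drop is the
  -- return from the last edge to `e`.
  obtain ⟨e, he, hmin⟩ := S.exists_min_image (D.windingAngle t) hne
  obtain ⟨-, hdir, hord⟩ := hO e he
  have hmem : ∀ i : ℕ, (ρ ^ i) e ∈ S := by
    intro i
    induction i with
    | zero => simpa
    | succ i ih => rw [pow_succ', Equiv.Perm.mul_apply]; exact (hS _ ih).1
  have hang : ∀ x ∈ S, ccwAngle (D.windingDir e) (D.windingDir x) =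
      D.windingAngle t x - D.windingAngle t e := by
    intro x hx
    rw [← D.coe_windingAngle t e, ← D.coe_windingAngle t x]
    exact ccwAngle_coe (hmin x hx) (by linarith [D.windingAngle_lt t x, D.le_windingAngle t e])
  have hmono : ∀ i j : ℕ, i < j → j < S.card →
      D.windingAngle t ((ρ ^ i) e) < D.windingAngle t ((ρ ^ j) e) := by
    intro i j hij hj
    have := hord i j hij hj
    rw [hang _ (hmem i), hang _ (hmem j)] at this
    linarith
  have hinj : ∀ i j : ℕ, i < S.card → j < S.card → (ρ ^ i) e = (ρ ^ j) e → i = j := by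
    intro i j hi hj h
    rcases lt_trichotomy i j with h' | h' | h'
    · exact absurd (hmono i j h' hj) (by rw [h]; exact lt_irrefl _)
    · exact h'
    · exact absurd (hmono j i h' hi) (by rw [h]; exact lt_irrefl _)
  have himg : (Finset.range S.card).image (fun i => (ρ ^ i) e) = S := by
    refine Finset.eq_of_subset_of_card_le ?_ ?_
    · intro x hx
      obtain ⟨i, -, rfl⟩ := Finset.mem_image.1 hx
      exact hmem i
    · rw [Finset.card_image_of_injOn, Finset.card_range]
      intro i hi j hj h
      exact hinj i j (by simpa using hi) (by simpa using hj) h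
  have hsurj : ∀ x ∈ S, ∃ i < S.card, (ρ ^ i) e = x := by
    intro x hx
    rw [← himg] at hx
    simpa using hx
  have hpos : 0 < S.card := hne.card_pos
  have hlast : ρ⁻¹ e = (ρ ^ (S.card - 1)) e := by
    obtain ⟨i, hi, hie⟩ := hsurj _ (hS e he).2
    rcases Nat.lt_or_ge i (S.card - 1) with hlt | hge
    · have h1 : (ρ ^ (i + 1)) e = (ρ ^ 0) e := by
        rw [pow_succ', Equiv.Perm.mul_apply, hie]; simp
      exact absurd (hinj _ _ (by omega) hpos h1) (by omega)
    · rw [← hie, show i = S.card - 1 by omega]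
  have hmax : ∀ x ∈ S, D.windingAngle t x ≤ D.windingAngle t (ρ⁻¹ e) := by
    intro x hx
    obtain ⟨i, hi, rfl⟩ := hsurj x hx
    rw [hlast]
    rcases Nat.lt_or_ge i (S.card - 1) with hlt | hge
    · exact (hmono _ _ hlt (by omega)).le
    · rw [show i = S.card - 1 by omega]
  refine ⟨e, he, fun x hx => ⟨fun h => ?_, ?_⟩, fun x hx => ⟨hmin x hx, hmax x hx⟩⟩
  · obtain ⟨i, hi, rfl⟩ := hsurj x hx
    rcases i with _ | i
    · simp
    · have h1 : ρ⁻¹ ((ρ ^ (i + 1)) e) = (ρ ^ i) e := by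
        rw [pow_succ', Equiv.Perm.mul_apply]; simp
      rw [h1] at h
      exact absurd h (hmono i (i + 1) (by omega) hi).not_gt
  · rintro rfl
    -- At a node with a single edge monotonicity says nothing; strictness comes from the condition
    -- on paths that cross at an edge.
    refine lt_of_le_of_ne (hmin _ (hS x hx).2) fun h => hdir ?_
    exact (D.windingAngle_eq_iff.1 h).symm

variable {D} in
theorem ProperlyOrdered.exists_descent_white (hD : D.ProperlyOrdered) (e₀ : E) :
    ∃ e, D.white e = D.white e₀ ∧ (∀ x, D.white x = D.white e₀ →
      (D.windingAngle t x < D.windingAngle t (D.rotW⁻¹ x) ↔ x = e)) ∧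
      ∀ x, D.white x = D.white e₀ → D.windingAngle t e ≤ D.windingAngle t x ∧
        D.windingAngle t x ≤ D.windingAngle t (D.rotW⁻¹ e) := by
  have hmem : ∀ x, x ∈ D.edgesW (D.white e₀) ↔ D.white x = D.white e₀ := by simp [edgesW]
  have := D.exists_unique_descent t (ρ := D.rotW) (S := D.edgesW (D.white e₀))
    (fun e he => by
      simp only [hmem, D.white_rotW, D.white_rotW_inv] at he ⊢
      exact ⟨he, he⟩)
    (hD.1 _) ⟨e₀, by rw [hmem]⟩
  simpa only [hmem] using this

variable {D} in
-- The drop is expressed with `rotW⁻¹` although the node is black: `rotB⁻¹ x` and `rotW⁻¹ x` lie on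
-- the same zigzag path. Hence both endpoints of an edge agree on whether it is selected.
theorem ProperlyOrdered.exists_descent_black (hD : D.ProperlyOrdered) (e₀ : E) :
    ∃ e, D.black e = D.black e₀ ∧ (∀ x, D.black x = D.black e₀ →
      (D.windingAngle t x < D.windingAngle t (D.rotW⁻¹ x) ↔ x = e)) ∧
      ∀ x, D.black x = D.black e₀ → D.windingAngle t e ≤ D.windingAngle t x ∧
        D.windingAngle t x ≤ D.windingAngle t (D.rotB⁻¹ e) := by
  have hmem : ∀ x, x ∈ D.edgesB (D.black e₀) ↔ D.black x = D.black e₀ := by simp [edgesB]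
  have := D.exists_unique_descent t (ρ := D.rotB) (S := D.edgesB (D.black e₀))
    (fun e he => by
      simp only [hmem, D.black_rotB, D.black_rotB_inv] at he ⊢
      exact ⟨he, he⟩)
    (hD.2 _) ⟨e₀, by rw [hmem]⟩
  simpa only [hmem, D.windingAngle_rotB_inv t] using this

/-- The edges where the polar angles in `[t, t + 2π)` decrease. -/
noncomputable def descents : Finset E :=
  Finset.univ.filter fun e => D.windingAngle t e < D.windingAngle t (D.rotW⁻¹ e)

theorem mem_descents {e : E} :
    e ∈ D.descents t ↔ D.windingAngle t e < D.windingAngle t (D.rotW⁻¹ e) := by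
  simp [descents]

variable {D} in
theorem ProperlyOrdered.isPerfectMatching_descents (hD : D.ProperlyOrdered)
    (hW : Function.Surjective D.white) (hB : Function.Surjective D.black) :
    D.IsPerfectMatching (D.descents t) := by
  constructor
  · intro v
    obtain ⟨e₀, rfl⟩ := hW v
    obtain ⟨e, he, h, -⟩ := hD.exists_descent_white t e₀
    refine ⟨e, ⟨(D.mem_descents t).2 ((h e he).2 rfl), he⟩, ?_⟩
    rintro y ⟨hy, hyv⟩
    exact (h y hyv).1 ((D.mem_descents t).1 hy)
  · intro v
    obtain ⟨e₀, rfl⟩ := hB v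
    obtain ⟨e, he, h, -⟩ := hD.exists_descent_black t e₀
    refine ⟨e, ⟨(D.mem_descents t).2 ((h e he).2 rfl), he⟩, ?_⟩
    rintro y ⟨hy, hyv⟩
    exact (h y hyv).1 ((D.mem_descents t).1 hy)

variable {t} in
theorem ccwAngle_ray_windingDir (e : E) :
    ccwAngle (t : Real.Angle) (D.windingDir e) = D.windingAngle t e - t := by
  rw [← D.coe_windingAngle t e]
  exact ccwAngle_coe (D.le_windingAngle t e) (D.windingAngle_lt t e)

variable {t} in
theorem ne_windingAngle (ht : D.IsGenericRay t) (e : E) : t < D.windingAngle t e :=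
  lt_of_le_of_ne (D.le_windingAngle t e) fun h => ht e (by rw [← D.coe_windingAngle t e, ← h])

variable {t} in
theorem ccwAngle_windingDir_ray (ht : D.IsGenericRay t) (e : E) :
    ccwAngle (D.windingDir e) (t : Real.Angle) = t + 2 * Real.pi - D.windingAngle t e := by
  rw [← D.coe_windingAngle t e]
  exact ccwAngle_coe_of_lt (D.ne_windingAngle ht e) (D.windingAngle_lt t e).le

variable {D t} in
theorem ProperlyOrdered.rayMatching_eq (hD : D.ProperlyOrdered) (ht : D.IsGenericRay t) :
    D.rayMatching t = D.descents t := by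
  have hmW : ∀ v x, x ∈ D.edgesW v ↔ D.white x = v := by simp [edgesW]
  have hmB : ∀ v x, x ∈ D.edgesB v ↔ D.black x = v := by simp [edgesB]
  ext e
  obtain ⟨a, ha, ha1, ha2⟩ := hD.exists_descent_white t e
  have hneW : D.windingAngle t (D.rotW⁻¹ e) ≠ D.windingAngle t e := fun h =>
    ((hD.1 (D.white e)) e ((hmW _ _).2 rfl)).2.1 (D.windingAngle_eq_iff.1 h)
  simp only [rayMatching, Finset.mem_filter, Finset.mem_univ, true_and]
  simp only [IsChosen, D.ccwAngle_ray_windingDir, D.ccwAngle_windingDir_ray ht,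
    hmW, hmB, mem_descents]
  constructor
  · rintro (h | h)
    · have h2 := (h.2 (D.rotW⁻¹ e) (D.white_rotW_inv e)).2
      exact lt_of_le_of_ne (by linarith) hneW.symm
    · have h2 := (h.2 (D.rotB⁻¹ e) (D.black_rotB_inv e)).2
      rw [windingAngle_rotB_inv] at h2
      exact lt_of_le_of_ne (by linarith) hneW.symm
  · intro h
    refine Or.inl ⟨trivial, fun x hx => ?_⟩
    obtain rfl := (ha1 e rfl).1 h
    have := ha2 x hx
    constructor <;> linarith

end TorusDimer

/-! ### Winding numbers as positive combinations, and extreme directions. -/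

open Classical in
/-- A sum over a union of cycles, as a sum of averages over the cycles. -/
theorem sum_cycle_average {E : Type*} [Fintype E] {σ : Equiv.Perm E} {S : Finset E}
    (hS : ∀ x, σ x ∈ S ↔ x ∈ S) (g : E → ℝ) :
    ∑ x ∈ S, ((Finset.univ.filter fun y => σ.SameCycle x y).card : ℝ)⁻¹ *
      ∑ y with σ.SameCycle x y, g y = ∑ y ∈ S, g y := by
  have hmem : ∀ {x y}, σ.SameCycle x y → (x ∈ S ↔ y ∈ S) := fun h =>
    iff_of_eq (apply_eq_of_sameCycle (f := fun x => x ∈ S) (fun e => propext (hS e)) h)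
  have hsame : ∀ {x y}, σ.SameCycle x y → ∀ z, σ.SameCycle x z ↔ σ.SameCycle y z :=
    fun h z => ⟨h.symm.trans, h.trans⟩
  have h1 : ∀ x ∈ S, ((Finset.univ.filter fun y => σ.SameCycle x y).card : ℝ)⁻¹ *
      ∑ y with σ.SameCycle x y, g y = ∑ y ∈ S, if σ.SameCycle y x then
        ((Finset.univ.filter fun z => σ.SameCycle y z).card : ℝ)⁻¹ * g y else 0 := by
    intro x hx
    rw [Finset.mul_sum, ← Finset.sum_filter]
    refine Finset.sum_congr ?_ fun y hy => ?_
    · ext y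
      simp only [Finset.mem_filter, Finset.mem_univ, true_and]
      exact ⟨fun h => ⟨(hmem h).1 hx, h.symm⟩, fun h => h.2.symm⟩
    · rw [Finset.mem_filter] at hy
      simp only [hsame hy.2]
  rw [Finset.sum_congr rfl h1, Finset.sum_comm]
  refine Finset.sum_congr rfl fun y hy => ?_
  rw [← Finset.sum_filter, Finset.sum_const, nsmul_eq_mul, ← mul_assoc]
  have h2 : {x ∈ S | σ.SameCycle y x} = Finset.univ.filter fun x => σ.SameCycle y x := by
    ext x
    simp only [Finset.mem_filter, Finset.mem_univ, true_and, and_iff_right_iff_imp]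
    exact fun h => (hmem h).1 hy
  have h3 : (Finset.univ.filter fun x => σ.SameCycle y x).card ≠ 0 :=
    Finset.card_ne_zero.2 ⟨y, by simp [Equiv.Perm.SameCycle.refl]⟩
  rw [h2, mul_inv_cancel₀ (Nat.cast_ne_zero.2 h3), one_mul]

namespace TorusDimer

variable {W B E : Type*} [Fintype E] (D : TorusDimer W B E) (t : ℝ)

open Classical in
/-- The length of the winding number, divided by the number of edges of the zigzag path. -/
noncomputable def windingWeight (e : E) : ℝ :=
  ((Finset.univ.filter fun y => D.zigzag.SameCycle e y).card : ℝ)⁻¹ * D.windingNorm e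

theorem windingWeight_pos {e : E} (h : D.winding e ≠ 0) : 0 < D.windingWeight e := by
  classical
  refine mul_pos (inv_pos.2 (Nat.cast_pos.2 (Finset.card_pos.2 ⟨e, ?_⟩))) (D.windingNorm_pos h)
  simp [Equiv.Perm.SameCycle.refl]

theorem shift_fst {S : Finset E} (hS : D.IsZigzagUnion S) :
    ((D.shift S).1 : ℝ) = ∑ x ∈ S, D.windingWeight x * Real.cos (D.windingAngle t x) := by
  classical
  have h := sum_cycle_average hS fun x => (((D.disp (D.rotW x) - D.disp x).1 : ℤ) : ℝ)
  rw [shift, Prod.fst_sum, Int.cast_sum, ← h]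
  refine Finset.sum_congr rfl fun x _ => ?_
  rw [windingWeight, mul_assoc, ← winding_fst, winding, Prod.fst_sum, Int.cast_sum]

theorem shift_snd {S : Finset E} (hS : D.IsZigzagUnion S) :
    ((D.shift S).2 : ℝ) = ∑ x ∈ S, D.windingWeight x * Real.sin (D.windingAngle t x) := by
  classical
  have h := sum_cycle_average hS fun x => (((D.disp (D.rotW x) - D.disp x).2 : ℤ) : ℝ)
  rw [shift, Prod.snd_sum, Int.cast_sum, ← h]
  refine Finset.sum_congr rfl fun x _ => ?_
  rw [windingWeight, mul_assoc, ← winding_snd, winding, Prod.snd_sum, Int.cast_sum]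

/-- Taken together, the zigzag paths traverse each edge once in each direction. -/
theorem shift_univ : D.shift Finset.univ = 0 := by
  rw [shift, Finset.sum_sub_distrib, Equiv.sum_comp D.rotW D.disp, sub_self]

/-- The edges whose zigzag paths wind in the direction of the polar angle `θ ∈ [t, t + 2π)`. -/
noncomputable def level (θ : ℝ) : Finset E :=
  Finset.univ.filter fun e => D.windingAngle t e = θ

variable {t} in
theorem mem_level {θ : ℝ} {e : E} : e ∈ D.level t θ ↔ D.windingAngle t e = θ := by
  simp [level]

theorem isZigzagUnion_level (θ : ℝ) : D.IsZigzagUnion (D.level t θ) := fun x => by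
  rw [mem_level, mem_level, windingAngle_zigzag]

theorem isZigzagUnion_univ : D.IsZigzagUnion Finset.univ := fun x => by simp

variable {D}

theorem ProperlyOrdered.winding_ne_zero (hD : D.ProperlyOrdered) (e : E) : D.winding e ≠ 0 :=
  (hD.1 (D.white e) e (by simp [edgesW])).1

theorem ProperlyOrdered.windingAngle_rotW_ne (hD : D.ProperlyOrdered) (e : E) :
    D.windingAngle t (D.rotW e) ≠ D.windingAngle t e := by
  have h := (hD.1 (D.white (D.rotW e)) (D.rotW e) (by simp [edgesW])).2.1
  intro h'
  refine h ?_
  rw [Equiv.Perm.inv_eq_iff_eq.2 rfl]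
  exact (D.windingAngle_eq_iff.1 h').symm

theorem ProperlyOrdered.rotW_ne (hD : D.ProperlyOrdered) (e : E) : D.rotW e ≠ e := fun h =>
  hD.windingAngle_rotW_ne 0 e (by rw [h])

theorem ProperlyOrdered.rotB_ne (hD : D.ProperlyOrdered) (e : E) : D.rotB e ≠ e := by
  have h := (hD.2 (D.black e) e (by simp [edgesB])).2.1
  intro h'
  refine h ?_
  rw [Equiv.Perm.inv_eq_iff_eq.2 h'.symm]

/-- A union of zigzag paths of the same direction winds in this direction. -/
theorem ProperlyOrdered.exists_shift_eq (hD : D.ProperlyOrdered) {S : Finset E}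
    (hS : D.IsZigzagUnion S) {θ : ℝ} (hSθ : S ⊆ D.level t θ) :
    ∃ q : ℝ, 0 ≤ q ∧ (q = 0 → S = ∅) ∧ ((D.shift S).1 : ℝ) = q * Real.cos θ ∧
      ((D.shift S).2 : ℝ) = q * Real.sin θ := by
  refine ⟨∑ x ∈ S, D.windingWeight x,
    Finset.sum_nonneg fun x _ => (D.windingWeight_pos (hD.winding_ne_zero x)).le,
    fun h => ?_, ?_, ?_⟩
  · by_contra hne
    exact (Finset.sum_pos (fun x _ => D.windingWeight_pos (hD.winding_ne_zero x))
      (Finset.nonempty_iff_ne_empty.2 hne)).ne' h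
  · rw [D.shift_fst t hS, Finset.sum_mul]
    exact Finset.sum_congr rfl fun x hx => by rw [D.mem_level.1 (hSθ hx)]
  · rw [D.shift_snd t hS, Finset.sum_mul]
    exact Finset.sum_congr rfl fun x hx => by rw [D.mem_level.1 (hSθ hx)]

/-- The winding directions do not fit into an open half plane. -/
theorem ProperlyOrdered.gap (hD : D.ProperlyOrdered) {a b : E}
    (ha : ∀ e, D.windingAngle t a ≤ D.windingAngle t e)
    (hb : ∀ e, D.windingAngle t e ≤ D.windingAngle t b) :
    Real.pi < D.windingAngle t b - D.windingAngle t a ∨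
      D.windingAngle t b - D.windingAngle t a = Real.pi ∧
        ∀ e, D.windingAngle t e = D.windingAngle t a ∨ D.windingAngle t e = D.windingAngle t b := by
  rcases lt_or_ge Real.pi (D.windingAngle t b - D.windingAngle t a) with h | h
  · exact Or.inl h
  · right
    have : Nonempty E := ⟨a⟩
    refine angles_of_sum_eq_zero (fun e => D.windingWeight_pos (hD.winding_ne_zero e)) ha hb ?_ ?_ h
    · rw [← D.shift_fst t D.isZigzagUnion_univ, shift_univ]; simp
    · rw [← D.shift_snd t D.isZigzagUnion_univ, shift_univ]; simp

/-- The other path through such an edge has a different angle, which can only be larger. The mirror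
statement for the largest angle selects the other edge of each turn; so the matching meets every
turn of the extreme paths. -/
theorem ProperlyOrdered.level_min_subset (hD : D.ProperlyOrdered) {a : E}
    (ha : ∀ e, D.windingAngle t a ≤ D.windingAngle t e) :
    D.level t (D.windingAngle t a) ⊆ D.descents t := by
  intro x hx
  rw [mem_level] at hx
  have h := hD.windingAngle_rotW_ne t (D.rotW⁻¹ x)
  rw [show D.rotW (D.rotW⁻¹ x) = x by simp] at h
  rw [mem_descents]
  exact lt_of_le_of_ne (hx ▸ ha _) h

theorem ProperlyOrdered.rotW_mem_descents (hD : D.ProperlyOrdered) {b x : E}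
    (hb : ∀ e, D.windingAngle t e ≤ D.windingAngle t b)
    (hx : x ∈ D.level t (D.windingAngle t b)) : D.rotW x ∈ D.descents t := by
  rw [mem_level] at hx
  rw [mem_descents, show D.rotW⁻¹ (D.rotW x) = x by simp]
  exact lt_of_le_of_ne (hx ▸ hb _) (hD.windingAngle_rotW_ne t x)

/-- If `M` contains every other edge of each zigzag path in `S`, then it becomes a perfect matching
that contains `S` when some of these zigzag paths are switched. -/
theorem ProperlyOrdered.exists_switch (hD : D.ProperlyOrdered) {M S : Finset E}
    (hM : D.IsPerfectMatching M) (hS : D.IsZigzagUnion S)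
    {θ : ℝ} (hSθ : S ⊆ D.level t θ) (hSM : ∀ x ∈ S, x ∈ M ∨ D.rotW x ∈ M) :
    ∃ Q ⊆ S, D.IsZigzagUnion Q ∧ ∃ M', D.IsPerfectMatching M' ∧ S ⊆ M' ∧
      D.totalDisp M' = D.totalDisp M - D.shift Q ∧ (Q = ∅ → M' = M) := by
  classical
  have hP := D.isZigzagUnion_filter hM hD.rotB_ne hS hSM
  have hQ : D.IsZigzagUnion {x ∈ S | x ∉ M} := by
    intro x
    have h1 := hP x
    have h2 : D.zigzag x ∈ S ↔ x ∈ S := hS x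
    simp only [Finset.mem_filter, h2] at h1 ⊢
    tauto
  have hQM : ({x ∈ S | x ∉ M}).image D.rotW ⊆ M := by
    intro y hy
    obtain ⟨x, hx, rfl⟩ := Finset.mem_image.1 hy
    rw [Finset.mem_filter] at hx
    exact (hSM x hx.1).resolve_left hx.2
  refine ⟨_, Finset.filter_subset _ _, hQ, _, D.isPerfectMatching_unflip hM hQ hQM, ?_,
    D.totalDisp_unflip hM hQM, fun h => by simp [h]⟩
  intro x hx
  by_cases hxM : x ∈ M
  · refine Finset.mem_union_left _ (Finset.mem_sdiff.2 ⟨hxM, fun h => ?_⟩)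
    obtain ⟨y, hy, rfl⟩ := Finset.mem_image.1 h
    rw [Finset.mem_filter] at hy
    exact hD.windingAngle_rotW_ne t y
      ((D.mem_level.1 (hSθ hx)).trans (D.mem_level.1 (hSθ hy.1)).symm)
  · exact Finset.mem_union_right _ (Finset.mem_filter.2 ⟨hx, hxM⟩)

end TorusDimer

/-! ### Turning the ray: uniqueness in a homology class and strict extremality. -/

theorem CoversOnce.eq_of_subset {E V : Type*} {node : E → V} {M M' : Finset E}
    (h : CoversOnce node M) (h' : CoversOnce node M') (hle : M ⊆ M') : M = M' := by
  refine hle.antisymm fun x hx => ?_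
  obtain ⟨y, ⟨hy, hyx⟩, -⟩ := h (node x)
  rwa [← h'.inj (hle hy) hx hyx]

namespace TorusDimer

variable {W B E : Type*} [Fintype E] {D : TorusDimer W B E} (t : ℝ)

/-- Turn the ray past the first winding direction. -/
theorem exists_next_ray {a : E} (ha : ∀ e, D.windingAngle t a ≤ D.windingAngle t e) :
    ∃ t' : ℝ, ∀ e, (D.windingAngle t e = D.windingAngle t a →
        D.windingAngle t' e = D.windingAngle t a + 2 * Real.pi) ∧
      (D.windingAngle t e ≠ D.windingAngle t a → D.windingAngle t' e = D.windingAngle t e) := by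
  classical
  -- The first direction becomes the last one. The new ray points in the direction of the smallest
  -- value of `β`, hence is not generic, which is why `descents` is used for all angles.
  let β : E → ℝ := fun e => if D.windingAngle t e = D.windingAngle t a then
    D.windingAngle t a + 2 * Real.pi else D.windingAngle t e
  have hpi := Real.pi_pos
  have hβ : ∀ e, D.windingAngle t a < β e ∧ β e ≤ D.windingAngle t a + 2 * Real.pi := by
    intro e
    by_cases h : D.windingAngle t e = D.windingAngle t a
    · simp [β, h, hpi]
    · simp only [β, h, if_false]
      exact ⟨lt_of_le_of_ne (ha e) (Ne.symm h),
        by linarith [D.windingAngle_lt t e, D.le_windingAngle t a]⟩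
  have : Nonempty E := ⟨a⟩
  obtain ⟨b, hb⟩ := Finite.exists_min β
  have key : ∀ e, D.windingAngle (β b) e = β e := by
    intro e
    refine D.windingAngle_eq_of_coe (hb e) (by linarith [(hβ e).2, (hβ b).1]) ?_
    rw [← D.coe_windingAngle t e]
    by_cases h : D.windingAngle t e = D.windingAngle t a
    · simp [β, h]
    · simp [β, h]
  refine ⟨β b, fun e => ⟨fun h => ?_, fun h => ?_⟩⟩
  · rw [key]; simp [β, h]
  · rw [key]; simp [β, h]

variable {t}

open Classical in
theorem ProperlyOrdered.descents_next (hD : D.ProperlyOrdered) {t' : ℝ} {a : E}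
    (ht' : ∀ e, (D.windingAngle t e = D.windingAngle t a →
        D.windingAngle t' e = D.windingAngle t a + 2 * Real.pi) ∧
      (D.windingAngle t e ≠ D.windingAngle t a → D.windingAngle t' e = D.windingAngle t e)) :
    D.descents t' = (D.descents t \ D.level t (D.windingAngle t a)) ∪
      (D.level t (D.windingAngle t a)).image D.rotW := by
  have hlt : ∀ e, D.windingAngle t e < D.windingAngle t a + 2 * Real.pi := fun e => by
    linarith [D.windingAngle_lt t e, D.le_windingAngle t a]
  ext e
  have himg : e ∈ (D.level t (D.windingAngle t a)).image D.rotW ↔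
      D.windingAngle t (D.rotW⁻¹ e) = D.windingAngle t a := by
    rw [Finset.mem_image]
    constructor
    · rintro ⟨x, hx, rfl⟩
      rw [show D.rotW⁻¹ (D.rotW x) = x by simp]
      exact D.mem_level.1 hx
    · exact fun h => ⟨D.rotW⁻¹ e, D.mem_level.2 h, by simp⟩
  have hne := hD.windingAngle_rotW_ne t (D.rotW⁻¹ e)
  rw [show D.rotW (D.rotW⁻¹ e) = e by simp] at hne
  rw [Finset.mem_union, Finset.mem_sdiff, himg, mem_descents, mem_descents, mem_level]
  by_cases h1 : D.windingAngle t e = D.windingAngle t a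
  · have h2 : D.windingAngle t (D.rotW⁻¹ e) ≠ D.windingAngle t a := fun h => hne (h1.trans h.symm)
    rw [(ht' e).1 h1, (ht' _).2 h2]
    refine iff_of_false (hlt _).not_gt ?_
    rintro (⟨-, h⟩ | h)
    exacts [h h1, h2 h]
  · rw [(ht' e).2 h1]
    by_cases h2 : D.windingAngle t (D.rotW⁻¹ e) = D.windingAngle t a
    · rw [(ht' _).1 h2]
      exact iff_of_true (hlt _) (Or.inr h2)
    · rw [(ht' _).2 h2]
      exact ⟨fun h => Or.inl ⟨h, h1⟩, fun h => (h.resolve_right h2).1⟩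

/-- If all winding directions are opposite, a matching that contains every other edge of the
zigzag paths of one direction is determined. -/
theorem eq_descents_of_opposite {a b : E}
    (hab : ∀ e, D.windingAngle t e = D.windingAngle t a ∨ D.windingAngle t e = D.windingAngle t b)
    (hb : ∀ e, D.windingAngle t e ≤ D.windingAngle t b)
    (hM₀ : D.IsPerfectMatching (D.descents t)) {M : Finset E} (hM : D.IsPerfectMatching M)
    (hle : D.level t (D.windingAngle t a) ⊆ M) : M = D.descents t := by
  -- With only two angles, every drop ends at the smaller one, so `descents t` is contained in `M`.
  refine (CoversOnce.eq_of_subset hM₀.1 hM.1 fun e he => hle ?_).symm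
  rw [mem_descents] at he
  rw [mem_level]
  exact (hab e).resolve_right fun h => (h ▸ he).not_ge (hb _)

theorem ProperlyOrdered.totalCrossings_min (hD : D.ProperlyOrdered)
    (hM₀ : D.IsPerfectMatching (D.descents t)) {a : E}
    (ha : ∀ e, D.windingAngle t a ≤ D.windingAngle t e) :
    D.totalCrossings (D.level t (D.windingAngle t a)) (D.descents t) =
      (D.level t (D.windingAngle t a)).card :=
  (D.totalCrossings_eq_card_iff hM₀ hD.rotW_ne).2 fun _ hx => Or.inl (hD.level_min_subset t ha hx)

theorem ProperlyOrdered.totalCrossings_max (hD : D.ProperlyOrdered)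
    (hM₀ : D.IsPerfectMatching (D.descents t)) {b : E}
    (hb : ∀ e, D.windingAngle t e ≤ D.windingAngle t b) :
    D.totalCrossings (D.level t (D.windingAngle t b)) (D.descents t) =
      (D.level t (D.windingAngle t b)).card :=
  (D.totalCrossings_eq_card_iff hM₀ hD.rotW_ne).2 fun _ hx => Or.inr (hD.rotW_mem_descents t hb hx)

/-- No perfect matching has more crossings with the zigzag paths in the extreme directions. -/
theorem ProperlyOrdered.wedge_shift_nonpos (hD : D.ProperlyOrdered)
    (hM₀ : D.IsPerfectMatching (D.descents t)) {M : Finset E} (hM : D.IsPerfectMatching M) {c : E}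
    (hc : D.totalCrossings (D.level t (D.windingAngle t c)) (D.descents t) =
      (D.level t (D.windingAngle t c)).card) :
    ((D.totalDisp M - D.totalDisp (D.descents t)).1 : ℝ) * Real.sin (D.windingAngle t c) -
      ((D.totalDisp M - D.totalDisp (D.descents t)).2 : ℝ) * Real.cos (D.windingAngle t c) ≤ 0 := by
  have h1 := D.totalCrossings_sub (D.isZigzagUnion_level t (D.windingAngle t c)) hM hM₀
  have h2 := D.totalCrossings_le (S := D.level t (D.windingAngle t c)) hM hD.rotW_ne
  have h3 : wedge (D.totalDisp M - D.totalDisp (D.descents t))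
      (D.shift (D.level t (D.windingAngle t c))) ≤ 0 := by omega
  obtain ⟨q, hq, hq0, hq1, hq2⟩ := hD.exists_shift_eq t
    (D.isZigzagUnion_level t (D.windingAngle t c)) (Finset.Subset.refl _)
  have hpos : 0 < q := lt_of_le_of_ne hq fun h => by
    have := hq0 h.symm
    exact Finset.notMem_empty c (this ▸ D.mem_level.2 rfl)
  have h4 : ((wedge (D.totalDisp M - D.totalDisp (D.descents t))
      (D.shift (D.level t (D.windingAngle t c))) : ℤ) : ℝ) ≤ 0 := by exact_mod_cast h3
  simp only [wedge, Int.cast_sub, Int.cast_mul, hq1, hq2] at h4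
  refine le_of_mul_le_mul_left ?_ hpos
  rw [mul_zero]
  linarith

/-- A perfect matching homologous to the one of a ray contains the first edges that this ray
switches. -/
theorem ProperlyOrdered.level_min_subset_of_totalDisp_eq (hD : D.ProperlyOrdered)
    (hM₀ : D.IsPerfectMatching (D.descents t)) {M : Finset E} (hM : D.IsPerfectMatching M)
    (h : D.totalDisp M = D.totalDisp (D.descents t)) {a : E}
    (ha : ∀ e, D.windingAngle t a ≤ D.windingAngle t e) :
    D.level t (D.windingAngle t a) ⊆ M := by
  have : Nonempty E := ⟨a⟩
  obtain ⟨b, hb⟩ := Finite.exists_max (D.windingAngle t)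
  have hZ := D.isZigzagUnion_level t (D.windingAngle t a)
  have hfull := (D.totalCrossings_eq_card_iff hM hD.rotW_ne).1 (by
    have h1 := D.totalCrossings_sub hZ hM hM₀
    rw [h, sub_self, hD.totalCrossings_min hM₀ ha] at h1
    simp only [wedge, Prod.fst_zero, Prod.snd_zero, zero_mul, sub_zero] at h1
    exact sub_eq_zero.1 h1)
  obtain ⟨Q, hQZ, hQ, M', hM', hZM', hdisp, hQM⟩ :=
    hD.exists_switch t hM hZ (Finset.Subset.refl _) hfull
  obtain ⟨q, hq, hq0, hq1, hq2⟩ := hD.exists_shift_eq t hQ hQZ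
  -- If `q = 0`, nothing was switched and `M` already contains the level. Otherwise `M'` is
  -- displaced by `-q` times the first direction, which the bound for the last direction excludes.
  suffices q = 0 by rwa [← hQM (hq0 this)]
  have hsub : D.totalDisp M' - D.totalDisp (D.descents t) = -D.shift Q := by
    rw [hdisp, h]; abel
  have hle := hD.wedge_shift_nonpos hM₀ hM' (hD.totalCrossings_max hM₀ hb)
  rw [hsub, Prod.fst_neg, Prod.snd_neg, Int.cast_neg, Int.cast_neg, hq1, hq2] at hle
  rcases hD.gap t ha hb with hgap | ⟨-, hab⟩
  · have hsin : Real.sin (D.windingAngle t b - D.windingAngle t a) < 0 := by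
      have h1 := Real.sin_neg_of_neg_of_neg_pi_lt
        (x := D.windingAngle t b - D.windingAngle t a - 2 * Real.pi)
        (by linarith [D.windingAngle_lt t b, D.le_windingAngle t a]) (by linarith)
      rwa [Real.sin_sub_two_pi] at h1
    rw [Real.sin_sub] at hsin
    nlinarith
  -- For opposite directions the bound is void, but `M'` is known explicitly, so the displacement is
  -- zero.
  · have h1 := eq_descents_of_opposite hab hb hM₀ hM' hZM'
    rw [h1, sub_self] at hsub
    have h0 : D.shift Q = 0 := by rw [← neg_eq_zero, ← hsub]
    rw [h0] at hq1 hq2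
    simp only [Prod.fst_zero, Prod.snd_zero, Int.cast_zero] at hq1 hq2
    have h2 := Real.sin_sq_add_cos_sq (D.windingAngle t a)
    have : q * (Real.sin (D.windingAngle t a) ^ 2 + Real.cos (D.windingAngle t a) ^ 2) = 0 := by
      linear_combination -Real.sin (D.windingAngle t a) * hq2 - Real.cos (D.windingAngle t a) * hq1
    rwa [h2, mul_one] at this

open Classical in
/-- A perfect matching homologous to the one of a ray is equal to it. -/
theorem ProperlyOrdered.mem_iff_of_totalDisp_eq (hD : D.ProperlyOrdered)
    (hM₀ : ∀ t, D.IsPerfectMatching (D.descents t)) (x : E) (n : ℕ) :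
    ∀ (t : ℝ) (M : Finset E), D.IsPerfectMatching M → D.totalDisp M = D.totalDisp (D.descents t) →
      ((Finset.univ.image (D.windingAngle t)).filter (· < D.windingAngle t x)).card = n →
      (x ∈ M ↔ x ∈ D.descents t) := by
  have : Nonempty E := ⟨x⟩
  induction n with
  | zero =>
    intro t M hM h hn
    have hmin : ∀ e, D.windingAngle t x ≤ D.windingAngle t e := by
      intro e
      by_contra hlt
      rw [Finset.card_eq_zero] at hn
      have : D.windingAngle t e ∈ (∅ : Finset ℝ) := by
        rw [← hn, Finset.mem_filter]
        exact ⟨Finset.mem_image_of_mem _ (Finset.mem_univ e), not_le.1 hlt⟩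
      exact Finset.notMem_empty _ this
    -- An edge in the first level belongs to both matchings.
    have h1 := hD.level_min_subset_of_totalDisp_eq (hM₀ t) hM h hmin (D.mem_level.2 rfl)
    have h2 := hD.level_min_subset t hmin (D.mem_level.2 rfl)
    exact iff_of_true h1 h2
  | succ n ih =>
    intro t M hM h hn
    obtain ⟨a, ha⟩ := Finite.exists_min (D.windingAngle t)
    obtain ⟨t', ht'⟩ := exists_next_ray t ha
    have hZ := D.isZigzagUnion_level t (D.windingAngle t a)
    have hZM := hD.level_min_subset_of_totalDisp_eq (hM₀ t) hM h ha
    have hZM₀ := hD.level_min_subset t ha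
    have hnext := hD.descents_next ht'
    have hxa : D.windingAngle t x ≠ D.windingAngle t a := by
      intro hxa
      rw [Finset.filter_false_of_mem] at hn
      · simp at hn
      · intro y hy
        obtain ⟨e, -, rfl⟩ := Finset.mem_image.1 hy
        rw [hxa]
        exact (ha e).not_gt
    -- Switching the first level keeps the matchings homologous and removes one of the angles below
    -- that of `x`.
    have hrec := ih t' _ (D.isPerfectMatching_flip hM hZ hZM)
      (by rw [D.totalDisp_flip hM hZM, hnext, D.totalDisp_flip (hM₀ t) hZM₀, h]) (by
        have hset : (Finset.univ.image (D.windingAngle t')).filter (· < D.windingAngle t' x) =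
            ((Finset.univ.image (D.windingAngle t)).filter (· < D.windingAngle t x)).erase
              (D.windingAngle t a) := by
          ext y
          rw [(ht' x).2 hxa]
          simp only [Finset.mem_filter, Finset.mem_image, Finset.mem_univ, true_and,
            Finset.mem_erase]
          constructor
          · rintro ⟨⟨e, rfl⟩, hlt⟩
            by_cases he : D.windingAngle t e = D.windingAngle t a
            · rw [(ht' e).1 he] at hlt
              linarith [D.windingAngle_lt t x, D.le_windingAngle t a]
            · rw [(ht' e).2 he] at hlt ⊢
              exact ⟨he, ⟨e, rfl⟩, hlt⟩
          · rintro ⟨he, ⟨e, rfl⟩, hlt⟩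
            exact ⟨⟨e, (ht' e).2 he⟩, hlt⟩
        rw [hset, Finset.card_erase_of_mem, hn, Nat.add_sub_cancel]
        rw [Finset.mem_filter]
        exact ⟨Finset.mem_image_of_mem _ (Finset.mem_univ a), lt_of_le_of_ne (ha x) (Ne.symm hxa)⟩)
    rw [hnext] at hrec
    have hxZ : x ∉ D.level t (D.windingAngle t a) := fun hx => hxa (D.mem_level.1 hx)
    -- The switch affects membership of `x` only if `x` is switched in; then its predecessor was in
    -- both matchings, and so `x` was in neither.
    by_cases himg : x ∈ (D.level t (D.windingAngle t a)).image D.rotW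
    · obtain ⟨y, hy, rfl⟩ := Finset.mem_image.1 himg
      exact iff_of_false (D.not_rotW_mem hM (hD.rotW_ne y) (hZM hy))
        (D.not_rotW_mem (hM₀ t) (hD.rotW_ne y) (hZM₀ hy))
    · simpa only [Finset.mem_union, Finset.mem_sdiff, hxZ, himg, not_false_eq_true, and_true,
        or_false] using hrec

theorem ProperlyOrdered.eq_descents_of_totalDisp_eq (hD : D.ProperlyOrdered)
    (hM₀ : ∀ t, D.IsPerfectMatching (D.descents t)) {M : Finset E} (hM : D.IsPerfectMatching M)
    (h : D.totalDisp M = D.totalDisp (D.descents t)) : M = D.descents t := by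
  ext x
  exact hD.mem_iff_of_totalDisp_eq hM₀ x _ t M hM h rfl

/-- The matching of a generic ray is the unique one that is extreme in the direction of the
ray. -/
theorem ProperlyOrdered.wedge_ray_neg (hD : D.ProperlyOrdered)
    (hM₀ : ∀ t, D.IsPerfectMatching (D.descents t)) (ht : D.IsGenericRay t) {M : Finset E}
    (hM : D.IsPerfectMatching M) (hne : M ≠ D.descents t) :
    ((D.totalDisp M - D.totalDisp (D.descents t)).1 : ℝ) * Real.sin t -
      ((D.totalDisp M - D.totalDisp (D.descents t)).2 : ℝ) * Real.cos t < 0 := by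
  rcases isEmpty_or_nonempty E with hE | hE
  · exact absurd (Subsingleton.elim _ _) hne
  obtain ⟨a, ha⟩ := Finite.exists_min (D.windingAngle t)
  obtain ⟨b, hb⟩ := Finite.exists_max (D.windingAngle t)
  have hfa := hD.wedge_shift_nonpos (hM₀ t) hM (hD.totalCrossings_min (hM₀ t) ha)
  have hfb := hD.wedge_shift_nonpos (hM₀ t) hM (hD.totalCrossings_max (hM₀ t) hb)
  have hta := D.ne_windingAngle ht a
  have htb := D.windingAngle_lt t b
  set v := D.totalDisp M - D.totalDisp (D.descents t) with hv
  set α := D.windingAngle t a with hα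
  set β := D.windingAngle t b with hβ
  have hpi := Real.pi_pos
  rcases hD.gap t ha hb with hgap | ⟨hgap, hab⟩
  · have s1 : 0 < Real.sin (α - β) := by
      rw [← Real.sin_add_two_pi]
      exact Real.sin_pos_of_pos_of_lt_pi (by linarith) (by linarith)
    have s2 : 0 < Real.sin (α - t) := Real.sin_pos_of_pos_of_lt_pi (by linarith) (by linarith)
    have s3 : 0 < Real.sin (t - β) := by
      rw [← Real.sin_add_two_pi]
      exact Real.sin_pos_of_pos_of_lt_pi (by linarith) (by linarith)
    -- The ray lies in the sector from `β` to `α + 2π`, of angle less than `π`, so its direction is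
    -- a positive combination of the two extreme ones. Failure of the strict inequality forces both
    -- extreme inequalities to be equalities, hence `v = 0`.
    have key : (v.1 * Real.sin t - v.2 * Real.cos t) * Real.sin (α - β) =
        Real.sin (α - t) * (v.1 * Real.sin β - v.2 * Real.cos β) +
          Real.sin (t - β) * (v.1 * Real.sin α - v.2 * Real.cos α) := by
      simp only [Real.sin_sub]
      ring
    by_contra hnn
    have hfa' : (v.1 * Real.sin α - v.2 * Real.cos α : ℝ) = 0 := by
      refine le_antisymm hfa (not_lt.1 fun h => ?_)
      nlinarith [mul_neg_of_pos_of_neg s3 h, mul_nonneg s2.le (neg_nonneg.2 hfb),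
        mul_nonneg (not_lt.1 hnn) s1.le]
    have hfb' : (v.1 * Real.sin β - v.2 * Real.cos β : ℝ) = 0 := by
      refine le_antisymm hfb (not_lt.1 fun h => ?_)
      nlinarith [mul_neg_of_pos_of_neg s2 h, mul_nonneg s3.le (neg_nonneg.2 hfa),
        mul_nonneg (not_lt.1 hnn) s1.le]
    rw [Real.sin_sub] at s1
    have v1 : (v.1 : ℝ) = 0 := by
      refine (mul_eq_zero.1 ?_).resolve_right s1.ne'
      linear_combination Real.cos β * hfa' - Real.cos α * hfb'
    have v2 : (v.2 : ℝ) = 0 := by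
      refine (mul_eq_zero.1 ?_).resolve_right s1.ne'
      linear_combination Real.sin β * hfa' - Real.sin α * hfb'
    refine hne (hD.eq_descents_of_totalDisp_eq hM₀ hM (sub_eq_zero.1 ?_))
    exact Prod.ext (by exact_mod_cast v1) (by exact_mod_cast v2)
  · have hβα : β = α + Real.pi := by linarith
    have hZ := D.isZigzagUnion_level t α
    have hfull := (D.totalCrossings_eq_card_iff hM hD.rotW_ne).1 (by
      have h1 := D.totalCrossings_sub hZ hM (hM₀ t)
      rw [hD.totalCrossings_min (hM₀ t) ha, ← hv] at h1
      have h2 : ((wedge v (D.shift (D.level t α)) : ℤ) : ℝ) = 0 := by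
        obtain ⟨q, -, -, hq1, hq2⟩ := hD.exists_shift_eq t hZ (Finset.Subset.refl _)
        simp only [wedge, Int.cast_sub, Int.cast_mul, hq1, hq2]
        -- The inequalities for two opposite directions together give an equality.
        have h3 := hfb
        rw [hβα, Real.sin_add_pi, Real.cos_add_pi] at h3
        have h4 : (v.1 * Real.sin α - v.2 * Real.cos α : ℝ) = 0 := by linarith [hfa]
        linear_combination q * h4
      have h3 : wedge v (D.shift (D.level t α)) = 0 := by exact_mod_cast h2
      rw [h3] at h1
      exact sub_eq_zero.1 h1)
    obtain ⟨Q, hQZ, hQ, M', hM', hZM', hdisp, hQM⟩ :=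
      hD.exists_switch t hM hZ (Finset.Subset.refl _) hfull
    obtain ⟨q, hq, hq0, hq1, hq2⟩ := hD.exists_shift_eq t hQ hQZ
    have hM'eq := eq_descents_of_opposite hab hb (hM₀ t) hM' hZM'
    -- Thus `v` is a positive multiple of the direction `α`, which is less than a half turn
    -- counterclockwise from the ray.
    have hvQ : v = D.shift Q := by rw [hv, ← hM'eq, hdisp]; abel
    have hq' : q ≠ 0 := fun h => hne ((hQM (hq0 h)).symm.trans hM'eq)
    have hsin : 0 < Real.sin (α - t) := Real.sin_pos_of_pos_of_lt_pi (by linarith) (by linarith)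
    rw [hvQ, hq1, hq2]
    have : q * Real.cos α * Real.sin t - q * Real.sin α * Real.cos t = -(q * Real.sin (α - t)) := by
      rw [Real.sin_sub]; ring
    rw [this]
    exact neg_neg_of_pos (mul_pos (lt_of_le_of_ne hq hq'.symm) hsin)

end TorusDimer

/-! ### The Kasteleyn determinant as a sum over matchings. -/

namespace TorusDimer

variable {W B E : Type*} (D : TorusDimer W B E)

theorem prod_single_exponents {ι : Type*} (s : Finset ι) (p : ι → ℤ × ℤ) (c : ι → ℂ) :
    ∏ i ∈ s, AddMonoidAlgebra.single (p i) (c i) =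
      (AddMonoidAlgebra.single (∑ i ∈ s, p i) (∏ i ∈ s, c i) : AddMonoidAlgebra ℂ (ℤ × ℤ)) := by
  classical
  induction s using Finset.induction_on with
  | empty => simp [AddMonoidAlgebra.one_def]
  | insert i s hi ih =>
    rw [Finset.prod_insert hi, Finset.prod_insert hi, Finset.sum_insert hi, ih,
      AddMonoidAlgebra.single_mul_single]

open Classical in
/-- The coefficients of the determinant of the Kasteleyn matrix, as sums over the matchings. -/
theorem coeff_det_kasteleyn [Fintype W] [DecidableEq W] [Fintype E] (c : E → ℂ) (a b : E → ℤ) (φ : W ≃ B)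
    (q : ℤ × ℤ) : ((D.kasteleyn c a b).submatrix id φ).det.coeff q =
      ∑ σ : Equiv.Perm W, ∑ F ∈ Fintype.piFinset fun i =>
          (Finset.univ.filter fun e => D.white e = σ i ∧ D.black e = φ i),
        (Equiv.Perm.sign σ : ℤ) • if ∑ i, (a (F i), b (F i)) = q then ∏ i, c (F i) else 0 := by
  have hL : ∀ x : AddMonoidAlgebra ℂ (ℤ × ℤ), x.coeff q =
    ((Finsupp.applyAddHom q).comp
      (AddMonoidAlgebra.coeffAddEquiv (R := ℂ) (M := ℤ × ℤ)).toAddMonoidHom) x := fun x => rfl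
  rw [hL, Matrix.det_apply, map_sum]
  refine Finset.sum_congr rfl fun σ _ => ?_
  rw [Units.smul_def, map_zsmul, ← Finset.smul_sum]
  congr 1
  simp only [Matrix.submatrix_apply, id_eq, kasteleyn]
  rw [Finset.prod_univ_sum, map_sum]
  refine Finset.sum_congr rfl fun F _ => ?_
  rw [prod_single_exponents, ← hL, AddMonoidAlgebra.coeff_single, Finsupp.single_apply]

theorem isPerfectMatching_image [Fintype W] [DecidableEq E] (σ : Equiv.Perm W) (φ : W ≃ B)
    {F : W → E} (hF : ∀ i, D.white (F i) = σ i ∧ D.black (F i) = φ i) :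
    D.IsPerfectMatching (Finset.univ.image F) ∧
      ∀ g : E → ℤ × ℤ, ∑ e ∈ Finset.univ.image F, g e = ∑ i, g (F i) := by
  have hinj : Function.Injective F := fun i j hij => σ.injective (by
    rw [← (hF i).1, hij, (hF j).1])
  refine ⟨⟨fun v => ⟨F (σ⁻¹ v), ⟨by simp, ?_⟩, ?_⟩, fun v => ⟨F (φ.symm v), ⟨by simp, ?_⟩, ?_⟩⟩,
    fun g => Finset.sum_image fun i _ j _ hij => hinj hij⟩
  · rw [(hF _).1]; simp
  · rintro y ⟨hy, rfl⟩
    obtain ⟨i, -, rfl⟩ := Finset.mem_image.1 hy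
    rw [(hF i).1]; simp
  · rw [(hF _).2]; simp
  · rintro y ⟨hy, rfl⟩
    obtain ⟨i, -, rfl⟩ := Finset.mem_image.1 hy
    rw [(hF i).2]; simp

theorem exists_perfectMatching_of_coeff_ne_zero [Fintype W] [DecidableEq W] [Fintype E] {c : E → ℂ} {a b : E → ℤ}
    {φ : W ≃ B} {q : ℤ × ℤ} (h : ((D.kasteleyn c a b).submatrix id φ).det.coeff q ≠ 0) :
    ∃ M, D.IsPerfectMatching M ∧ ∑ e ∈ M, (a e, b e) = q := by
  classical
  rw [coeff_det_kasteleyn] at h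
  obtain ⟨σ, -, h⟩ := Finset.exists_ne_zero_of_sum_ne_zero h
  obtain ⟨F, hF, h⟩ := Finset.exists_ne_zero_of_sum_ne_zero h
  have hq : ∑ i, (a (F i), b (F i)) = q := by
    by_contra hq
    simp [hq] at h
  simp only [Fintype.mem_piFinset, Finset.mem_filter, Finset.mem_univ, true_and] at hF
  obtain ⟨hM, hsum⟩ := D.isPerfectMatching_image σ φ hF
  exact ⟨_, hM, (hsum _).trans hq⟩

/-- No cancellation is possible: a single term of the expansion contributes to this exponent. -/
theorem exists_coeff_ne_zero [Fintype W] [DecidableEq W] [Fintype E] {c : E → ℂ} (hc : ∀ e, c e ≠ 0)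
    {a b : E → ℤ} {M : Finset E} (hM : D.IsPerfectMatching M)
    (huniq : ∀ M', D.IsPerfectMatching M' → ∑ e ∈ M', (a e, b e) = ∑ e ∈ M, (a e, b e) → M' = M) :
    ∃ φ : W ≃ B,
      ((D.kasteleyn c a b).submatrix id φ).det.coeff (∑ e ∈ M, (a e, b e)) ≠ 0 := by
  classical
  choose f hf using fun v => (hM.1 v).exists
  choose g hg using fun v => (hM.2 v).exists
  -- Columns are identified with rows by the matching itself, so that its term belongs to the
  -- identity permutation.
  let φ : W ≃ B :=
    { toFun := fun v => D.black (f v)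
      invFun := fun v => D.white (g v)
      left_inv := fun v => by
        have : g (D.black (f v)) = f v := CoversOnce.inj hM.2 (hg _).1 (hf _).1 (hg _).2
        simp only [this, (hf v).2]
      right_inv := fun v => by
        have : f (D.white (g v)) = g v := CoversOnce.inj hM.1 (hf _).1 (hg _).1 (hf _).2
        simp only [this, (hg v).2] }
  have hfinj : Function.Injective f := fun i j hij => by rw [← (hf i).2, hij, (hf j).2]
  have himg : Finset.univ.image f = M := by
    ext e
    rw [Finset.mem_image]
    constructor
    · rintro ⟨i, -, rfl⟩
      exact (hf i).1
    · exact fun he => ⟨D.white e, Finset.mem_univ _, CoversOnce.inj hM.1 (hf _).1 he (hf _).2⟩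
  have hsum : ∑ i, (a (f i), b (f i)) = ∑ e ∈ M, (a e, b e) := by
    rw [← himg, Finset.sum_image fun i _ j _ hij => hfinj hij]
  refine ⟨φ, ?_⟩
  rw [coeff_det_kasteleyn]
  have key : ∀ (σ : Equiv.Perm W) (F : W → E),
      (∀ i, D.white (F i) = σ i ∧ D.black (F i) = φ i) →
      ∑ i, (a (F i), b (F i)) = ∑ e ∈ M, (a e, b e) → σ = 1 ∧ F = f := by
    intro σ F hF hq
    obtain ⟨hFP, hsum⟩ := D.isPerfectMatching_image σ φ hF
    have hFM : Finset.univ.image F = M := huniq _ hFP ((hsum _).trans hq)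
    have hFf : F = f := funext fun i => CoversOnce.inj hM.2
      (hFM ▸ Finset.mem_image_of_mem F (Finset.mem_univ i)) (hf i).1 (hF i).2
    refine ⟨Equiv.ext fun i => ?_, hFf⟩
    rw [← (hF i).1, hFf, (hf i).2, Equiv.Perm.one_apply]
  rw [Finset.sum_eq_single 1, Finset.sum_eq_single f]
  · simp only [hsum, if_true, Equiv.Perm.sign_one, Units.val_one, one_smul]
    exact Finset.prod_ne_zero_iff.2 fun i _ => hc _
  · intro F hF hne
    simp only [Fintype.mem_piFinset, Finset.mem_filter, Finset.mem_univ, true_and] at hF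
    rw [if_neg fun hq => hne (key 1 F hF hq).2, smul_zero]
  · intro h
    refine absurd ?_ h
    simp only [Fintype.mem_piFinset, Finset.mem_filter, Finset.mem_univ, true_and]
    exact fun i => ⟨(hf i).2, rfl⟩
  · intro σ _ hne
    refine Finset.sum_eq_zero fun F hF => ?_
    simp only [Fintype.mem_piFinset, Finset.mem_filter, Finset.mem_univ, true_and] at hF
    rw [if_neg fun hq => hne (key σ F hF hq).1, smul_zero]
  · exact fun h => absurd (Finset.mem_univ _) h

variable {D}

theorem matchingPoint_eq (a b : E → ℤ) (M : Finset E) : matchingPoint a b M =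
    (((∑ e ∈ M, (a e, b e)).1 : ℝ), ((∑ e ∈ M, (a e, b e)).2 : ℝ)) := by
  simp [matchingPoint, Prod.fst_sum, Prod.snd_sum]

theorem matchingPoint_inj {a b : E → ℤ} {M M' : Finset E}
    (h : ∑ e ∈ M, (a e, b e) = ∑ e ∈ M', (a e, b e)) :
    matchingPoint a b M = matchingPoint a b M' := by
  rw [matchingPoint_eq, matchingPoint_eq, h]

theorem IsCrossingNumber.sum_sub {u : ℤ × ℤ} {a : E → ℤ} (ha : D.IsCrossingNumber u a)
    {M M' : Finset E} (hM : D.IsPerfectMatching M) (hM' : D.IsPerfectMatching M') :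
    ∑ e ∈ M, a e - ∑ e ∈ M', a e = wedge (D.totalDisp M - D.totalDisp M') u := by
  obtain ⟨f, g, hfg⟩ := ha
  have e1 := CoversOnce.sum_eq hM.1 hM'.1 (g := fun e => f (D.white e)) fun x y h => by rw [h]
  have e2 := CoversOnce.sum_eq hM.2 hM'.2 (g := fun e => g (D.black e)) fun x y h => by rw [h]
  simp only [hfg, Finset.sum_sub_distrib, Finset.sum_add_distrib, e1, e2]
  simp only [wedge, totalDisp, Prod.fst_sub, Prod.snd_sub, Prod.fst_sum, Prod.snd_sum, sub_mul,
    Finset.sum_mul, Finset.sum_sub_distrib]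
  ring

end TorusDimer

/-! ### Corners exposed by generic functionals, and the theorem. -/

theorem eq_zero_of_wedge_eq_zero {u v w : ℤ × ℤ} (huv : AddSubgroup.closure {u, v} = ⊤)
    (hu : wedge w u = 0) (hv : wedge w v = 0) : w = 0 := by
  have h : ∀ x : ℤ × ℤ, wedge w x = 0 := by
    intro x
    have hx : x ∈ AddSubgroup.closure {u, v} := huv ▸ AddSubgroup.mem_top x
    induction hx using AddSubgroup.closure_induction with
    | mem x hx => rcases hx with rfl | rfl <;> assumption
    | zero => simp [wedge]
    | add x y _ _ hx hy =>
      simp only [wedge, Prod.fst_add, Prod.snd_add] at hx hy ⊢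
      linarith
    | neg x _ hx =>
      simp only [wedge, Prod.fst_neg, Prod.snd_neg] at hx ⊢
      linarith
  have h1 := h (0, 1)
  have h2 := h (1, 0)
  simp only [wedge] at h1 h2
  exact Prod.ext (by simpa using h1) (by simpa using h2)

open Filter Topology in
theorem eventually_quadratic_ne_zero {A B C : ℝ} (h : B ≠ 0 ∨ C ≠ 0) :
    ∀ᶠ s in 𝓝[>] (0 : ℝ), A + s * B + s ^ 2 * C ≠ 0 := by
  have hp : (Polynomial.C A + Polynomial.X * Polynomial.C B + Polynomial.X ^ 2 * Polynomial.C C :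
      Polynomial ℝ) ≠ 0 := by
    intro h0
    rcases h with h | h
    · have := congrArg (fun p => Polynomial.coeff p 1) h0
      simp [Polynomial.coeff_X_pow, Polynomial.coeff_C] at this
      exact h this
    · have := congrArg (fun p => Polynomial.coeff p 2) h0
      simp at this
      exact h this
  have hfin := (Polynomial.finite_setOfPred_isRoot hp).subset (Set.sdiff_subset (t := {0}))
  have h1 := hfin.isClosed.isOpen_compl.mem_nhds (x := 0) (by simp)
  filter_upwards [nhdsWithin_le_nhds h1, self_mem_nhdsWithin] with s hs hpos h0
  refine hs ⟨?_, (Set.mem_Ioi.1 hpos).ne'⟩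
  simpa [Polynomial.IsRoot, mul_comm B, mul_comm C] using h0

open Filter Topology in
/-- An extreme point of the convex hull of a finite set is exposed by a linear functional that is
generic with respect to finitely many conditions. -/
theorem exists_generic_functional {S : Set (ℝ × ℝ)} (hS : S.Finite) {p : ℝ × ℝ}
    (hp : p ∈ (convexHull ℝ S).extremePoints ℝ) {I : Type*} [Finite I] {x y : I → ℝ}
    (hxy : ∀ i, x i ≠ 0 ∨ y i ≠ 0) :
    ∃ k l : ℝ, (∀ i, k * x i + l * y i ≠ 0) ∧
      ∀ s ∈ S, s ≠ p → k * s.1 + l * s.2 < k * p.1 + l * p.2 := by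
  have hp₁ := (Convex.mem_extremePoints_iff_mem_sdiff_convexHull_sdiff (𝕜 := ℝ)
    (convex_convexHull ℝ S)).1 hp
  have hp' : p ∉ convexHull ℝ (S \ {p}) := fun h =>
    hp₁.2 ((convexHull ℝ).monotone (Set.sdiff_subset_sdiff_left (subset_convexHull ℝ S)) h)
  obtain ⟨f, c, hf1, hf2⟩ := geometric_hahn_banach_closed_point (convex_convexHull ℝ (S \ {p}))
    (Set.Finite.isClosed_convexHull ℝ (hS.subset Set.sdiff_subset)) hp'
  have hf : ∀ z : ℝ × ℝ, f z = f (1, 0) * z.1 + f (0, 1) * z.2 := by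
    intro z
    have : z = z.1 • ((1 : ℝ), (0 : ℝ)) + z.2 • ((0 : ℝ), (1 : ℝ)) := by ext <;> simp
    conv_lhs => rw [this]
    rw [map_add, map_smul, map_smul, smul_eq_mul, smul_eq_mul]
    ring
  -- Perturb the exposing functional by `(s, s ^ 2)`: each condition becomes a nonconstant
  -- polynomial in `s`, and the finitely many strict inequalities survive for small `s`.
  have h1 : ∀ᶠ s in 𝓝[>] (0 : ℝ), ∀ i,
      (f (1, 0) + s) * x i + (f (0, 1) + s ^ 2) * y i ≠ 0 := by
    rw [eventually_all]
    intro i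
    filter_upwards [eventually_quadratic_ne_zero (A := f (1, 0) * x i + f (0, 1) * y i) (hxy i)]
      with s hs h0
    exact hs (by linarith)
  have h2 : ∀ᶠ s in 𝓝[>] (0 : ℝ), ∀ z ∈ S \ {p},
      (f (1, 0) + s) * z.1 + (f (0, 1) + s ^ 2) * z.2 <
        (f (1, 0) + s) * p.1 + (f (0, 1) + s ^ 2) * p.2 := by
    refine nhdsWithin_le_nhds ((hS.subset Set.sdiff_subset).eventually_all.2 fun z hz => ?_)
    refine ContinuousAt.eventually_lt (by fun_prop) (by fun_prop) ?_
    have := (hf1 z (subset_convexHull ℝ _ hz)).trans hf2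
    rw [hf z, hf p] at this
    simpa using this
  obtain ⟨s, hs1, hs2⟩ := (h1.and h2).exists
  exact ⟨_, _, hs1, fun z hz hzp => hs2 z ⟨hz, hzp⟩⟩

theorem mainTheorem3 {W B E : Type*} [Fintype W] [Fintype B] [Fintype E]
    (D : TorusDimer W B E) (hD : D.ProperlyOrdered)
    (u v : ℤ × ℤ) (huv : AddSubgroup.closure {u, v} = ⊤)
    (a b : E → ℤ) (ha : D.IsCrossingNumber u a) (hb : D.IsCrossingNumber v b)
    (c : E → ℂ) (hc : ∀ e, c e ≠ 0)
    (p : ℝ × ℝ) (hp : p ∈ (D.toricDiagram c a b).extremePoints ℝ) :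
    (∃! M : Finset E, D.IsPerfectMatching M ∧ TorusDimer.matchingPoint a b M = p) ∧
      ∃ r : Real.Angle, D.IsGenericRay r ∧ D.IsPerfectMatching (D.rayMatching r) ∧
        TorusDimer.matchingPoint a b (D.rayMatching r) = p := by
  classical
  unfold TorusDimer.toricDiagram at hp
  set S := {x : ℝ × ℝ | ∃ φ : W ≃ B, ∃ p : ℤ × ℤ,
    ((D.kasteleyn c a b).submatrix id φ).det.coeff p ≠ 0 ∧ x = ((p.1 : ℝ), (p.2 : ℝ))} with hSdef
  have hSM : ∀ x ∈ S, ∃ M, D.IsPerfectMatching M ∧ TorusDimer.matchingPoint a b M = x := by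
    rintro x ⟨φ, q, hq, rfl⟩
    obtain ⟨M, hM, hMq⟩ := D.exists_perfectMatching_of_coeff_ne_zero hq
    exact ⟨M, hM, by rw [TorusDimer.matchingPoint_eq, hMq]⟩
  have hSfin : S.Finite := (Set.finite_range (TorusDimer.matchingPoint a b)).subset fun x hx => by
    obtain ⟨M, -, h⟩ := hSM x hx
    exact ⟨M, h⟩
  obtain ⟨M₀, hM₀, hM₀p⟩ := hSM p (extremePoints_convexHull_subset hp)
  -- A corner comes from some perfect matching, so no node is isolated.
  have hdesc : ∀ t, D.IsPerfectMatching (D.descents t) := fun t =>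
    hD.isPerfectMatching_descents t
      (fun w => (hM₀.1 w).exists.imp fun _ h => h.2) fun w => (hM₀.2 w).exists.imp fun _ h => h.2
  obtain ⟨k, l, hkl, hmax⟩ := exists_generic_functional hSfin hp
    (x := fun e => ((wedge (D.winding e) u : ℤ) : ℝ))
    (y := fun e => ((wedge (D.winding e) v : ℤ) : ℝ)) (fun e => by
      by_contra! h
      exact hD.winding_ne_zero e (eq_zero_of_wedge_eq_zero huv (by exact_mod_cast h.1)
        (by exact_mod_cast h.2)))
  -- The functional `(k, l)` on exponents is, on displacements, the exterior product with `k u + l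
  -- v`; this vector gives the ray.
  let y : ℂ := ⟨k * u.1 + l * v.1, k * u.2 + l * v.2⟩
  have hre : ‖y‖ * Real.cos y.arg = k * u.1 + l * v.1 := Complex.norm_mul_cos_arg y
  have him : ‖y‖ * Real.sin y.arg = k * u.2 + l * v.2 := Complex.norm_mul_sin_arg y
  have hy : ∀ d : ℤ × ℤ, k * (wedge d u : ℤ) + l * (wedge d v : ℤ) =
      ‖y‖ * (d.1 * Real.sin y.arg - d.2 * Real.cos y.arg) := by
    intro d
    simp only [wedge]
    push_cast
    linear_combination (d.2 : ℝ) * hre - d.1 * him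
  have hgen : D.IsGenericRay (y.arg : Real.Angle) := by
    intro e he
    have hangle : D.windingAngle y.arg e = y.arg :=
      D.windingAngle_eq_of_coe le_rfl (by linarith [Real.pi_pos]) he.symm
    refine hkl e ?_
    rw [hy, D.winding_fst y.arg e, D.winding_snd y.arg e, hangle]
    ring
  have hlt : ∀ M, D.IsPerfectMatching M → M ≠ D.descents y.arg →
      k * (TorusDimer.matchingPoint a b M).1 + l * (TorusDimer.matchingPoint a b M).2 <
        k * (TorusDimer.matchingPoint a b (D.descents y.arg)).1 +
          l * (TorusDimer.matchingPoint a b (D.descents y.arg)).2 := by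
    intro M hM hne
    have h1 := hD.wedge_ray_neg hdesc hgen hM hne
    -- If `y` were zero, the functional would vanish on every winding number, against its
    -- genericity.
    have hnorm : 0 < ‖y‖ := by
      refine lt_of_le_of_ne (norm_nonneg y) fun h0 => ?_
      rcases isEmpty_or_nonempty E with hE | ⟨⟨e⟩⟩
      · exact hne (Subsingleton.elim _ _)
      · refine hkl e ?_
        rw [hy, ← h0, zero_mul]
    have h2 := mul_neg_of_pos_of_neg hnorm h1
    rw [← hy, ← ha.sum_sub hM (hdesc _), ← hb.sum_sub hM (hdesc _)] at h2
    simp only [TorusDimer.matchingPoint]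
    push_cast at h2 ⊢
    linarith
  have hmem : TorusDimer.matchingPoint a b (D.descents y.arg) ∈ S := by
    obtain ⟨φ, hφ⟩ := D.exists_coeff_ne_zero hc (a := a) (b := b) (hdesc y.arg)
      fun M hM hMq => by
        by_contra hne
        have := hlt M hM hne
        rw [TorusDimer.matchingPoint_inj hMq] at this
        exact lt_irrefl _ this
    exact ⟨φ, _, hφ, TorusDimer.matchingPoint_eq _ _ _⟩
  -- Both points are maxima of the same functional: `p` strictly among the exponents that occur,
  -- `descents` strictly among perfect matchings.
  have hpoint : TorusDimer.matchingPoint a b (D.descents y.arg) = p := by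
    by_contra hne
    have h1 := hmax _ hmem hne
    rw [← hM₀p] at h1
    by_cases h : M₀ = D.descents y.arg
    · rw [h] at h1
      exact lt_irrefl _ h1
    · exact lt_asymm h1 (hlt M₀ hM₀ h)
  refine ⟨⟨D.descents y.arg, ⟨hdesc _, hpoint⟩, ?_⟩, (y.arg : Real.Angle), hgen, ?_⟩
  · rintro M ⟨hM, hMp⟩
    by_contra hne
    have := hlt M hM hne
    rw [hMp, hpoint] at this
    exact lt_irrefl _ this
  · rw [hD.rayMatching_eq hgen]
    exact ⟨hdesc _, hpoint⟩
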